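/- Let $\Gamma$ be a metric graph: a finite connected multigraph (loops and parallel edges allowed) with non-empty vertex set $B(\Gamma)$, each edge $e$ of which is identified with an interval $[0,\ell_e]$, $\ell_e>0$, whose ends are glued to the end vertices of $e$. A segment is a subinterval $[a,b]$, $a<b$, of an edge. A divisor is an element $D=\sum_v D(v)(v)$ of the free abelian group on the points of $\Gamma$; it is effective ($D\ge 0$) if all $D(v)\ge 0$, and $\deg D=\sum_v D(v)$, $\deg^+D=\sum_v\max\{0,D(v)\}$. A rational function $f$ on $\Gamma$ is a continuous real function that on each edge is piecewise linear with finitely many pieces and integral slopes; $D_f$ is the divisor whose value at $v$ is the sum of the outgoing slopes of $f$ at $v$. Write $D\sim D'$ if $D=D'+D_f$ for some rational function $f$, $|D|=\{E\ge 0: E\sim D\}$, and $r(D)=\min\{\deg E-1: E\ge 0,\ |D-E|=\emptyset\}$. A loop transversal $I$ is a set that contains exactly one interior point of every loop and no other points. Fix a loop transversal $I$. A permutation of points of $\Gamma$ is a finite sequence $P$ of distinct points of $\Gamma$ whose set of members $\operatorname{supp}P$ contains $B(\Gamma)\cup I$. A $P$-segment is a segment with both ends in $\operatorname{supp}P$ and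 interior disjoint from $\operatorname{supp}P$. For $v\in\operatorname{supp}P$ let $S_P(v)$ be the set of $P$-segments with one end at $v$ and the other end preceding $v$ in $P$, and let $\nu_P=\sum_{v\in\operatorname{supp}P}(|S_P(v)|-1)(v)$. A pair $(D',P)$ is a rank-pair for $D$ if $D'\sim D$ and $r(D)=\deg^+(D'-\nu_P)-1$. Lemma. For every metric graph $\Gamma$, every loop transversal $I$ of $\Gamma$ and every divisor $D$ on $\Gamma$ there exist a divisor $D'$, a spanning tree $T$ of $\Gamma$ and a permutation $P$ of points of $\Gamma$ (with respect to $I$) such that $(D',P)$ is a rank-pair for $D$, $D'$ is zero in the interior of every edge of $T$, and every edge $e\notin T$ contains at most one interior point $v$ with $D'(v)\ne 0$, and if such a point $v$ exists, then $D'(v)=1$. -/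

import Mathlib

/-- A metric graph: a multigraph (loops and parallel edges allowed) with vertex type `V` and edge
type `E`, connected, each of whose edges `e` is assigned a positive length. The edge `e` is
identified with the interval `[0, len e]`, where `0` is glued to the vertex `src e` and `len e` to
the vertex `tgt e`; this orientation only serves as a parametrization of the edge. -/
structure MetricGraph (V E : Type*) where
  src : E → V
  tgt : E → V
  len : E → ℝ
  len_pos : ∀ e, 0 < len e
  connected : ∀ u v, Relation.EqvGen (fun x y => ∃ e, src e = x ∧ tgt e = y) u v

namespace MetricGraph

/-- Two vertices are joined by a path all of whose edges belong to `T`. -/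
def JoinedBy {V E : Type*} (Γ : MetricGraph V E) (T : Set E) (u v : V) : Prop :=
  Relation.EqvGen (fun x y => ∃ e ∈ T, Γ.src e = x ∧ Γ.tgt e = y) u v

/-- `T` is the edge set of a spanning tree: the graph with all the vertices and with edge set `T`
is connected and has no cycle (no edge of `T` has its two ends joined by a path that uses only
other edges of `T`; in particular `T` contains no loop). -/
def IsSpanningTree {V E : Type*} (Γ : MetricGraph V E) (T : Set E) : Prop :=
  (∀ u v, Γ.JoinedBy T u v) ∧ ∀ e ∈ T, ¬ Γ.JoinedBy (T \ {e}) (Γ.src e) (Γ.tgt e)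

/-- The points of a metric graph: the vertices (branching points) and, for every edge `e`,
the internal points of `e`, given by their parameter in the open interval `(0, len e)`. -/
inductive Point {V E : Type*} (Γ : MetricGraph V E) where
  | vertex (v : V) : Point Γ
  | inner (e : E) (t : Set.Ioo (0 : ℝ) (Γ.len e)) : Point Γ

/-- The interior of an edge. -/
def interior {V E : Type*} (Γ : MetricGraph V E) (e : E) : Set Γ.Point :=
  Set.range (Point.inner e)

open Classical in
/-- The parametrization of the edge `e`: for `t` in `[0, len e]`, the point with parameter `t`
(the values for other `t` play no role). -/
noncomputable def pt {V E : Type*} (Γ : MetricGraph V E) (e : E) (t : ℝ) : Γ.Point :=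
  if h : t ∈ Set.Ioo (0 : ℝ) (Γ.len e) then .inner e ⟨t, h⟩
  else if t ≤ 0 then .vertex (Γ.src e) else .vertex (Γ.tgt e)

/-- Divisors: the free abelian group on the points. -/
abbrev Divisor {V E : Type*} (Γ : MetricGraph V E) : Type _ := Γ.Point →₀ ℤ

/-- The degree of a divisor. -/
def deg {V E : Type*} {Γ : MetricGraph V E} (D : Γ.Divisor) : ℤ :=
  D.sum fun _ n => n

/-- The sum of the positive coefficients of a divisor. -/
def degPos {V E : Type*} {Γ : MetricGraph V E} (D : Γ.Divisor) : ℤ :=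
  D.sum fun _ n => max 0 n

/-- Rational functions: continuous real functions that on every edge are piecewise linear with
integral slopes and finitely many linear parts. `S` is a finite set of parameters outside of which
the slope does not change. As the graph carries the quotient topology of its edges, continuity is
continuity on every (closed) edge. -/
def IsRational {V E : Type*} (Γ : MetricGraph V E) (f : Γ.Point → ℝ) : Prop :=
  ∀ e, ContinuousOn (fun t => f (Γ.pt e t)) (Set.Icc 0 (Γ.len e)) ∧
    ∃ S : Finset ℝ, ∀ a b : ℝ, 0 ≤ a → a < b → b ≤ Γ.len e → (∀ s ∈ S, s ∉ Set.Ioo a b) →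
      ∃ (m : ℤ) (c : ℝ), ∀ t ∈ Set.Ioo a b, f (Γ.pt e t) = m * t + c

/-- The slope of `f` at the parameter `t` of `e` in the direction of increasing parameters. -/
noncomputable def slopeForward {V E : Type*} (Γ : MetricGraph V E) (f : Γ.Point → ℝ)
    (e : E) (t : ℝ) : ℝ :=
  derivWithin (fun s => f (Γ.pt e s)) (Set.Ioi t) t

/-- The slope of `f` at the parameter `t` of `e` in the direction of decreasing parameters
(hence the minus sign). -/
noncomputable def slopeBackward {V E : Type*} (Γ : MetricGraph V E) (f : Γ.Point → ℝ)
    (e : E) (t : ℝ) : ℝ :=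
  - derivWithin (fun s => f (Γ.pt e s)) (Set.Iio t) t

open Classical in
/-- The order of a point with respect to `f`: the sum of the outgoing slopes of all the segments
emanating from the point. A loop contributes twice at its vertex. -/
noncomputable def ord {V E : Type*} [Fintype E] (Γ : MetricGraph V E) (f : Γ.Point → ℝ) :
    Γ.Point → ℝ
  | .vertex v => ∑ e, ((if Γ.src e = v then Γ.slopeForward f e 0 else 0) +
      (if Γ.tgt e = v then Γ.slopeBackward f e (Γ.len e) else 0))
  | .inner e t => Γ.slopeForward f e t + Γ.slopeBackward f e t

/-- Linear equivalence: `D = D' + D_f` for some rational function `f`, where `D_f` is the divisor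
`p ↦ ord_f p`. -/
def LinEquiv {V E : Type*} [Fintype E] {Γ : MetricGraph V E} (D D' : Γ.Divisor) : Prop :=
  ∃ f : Γ.Point → ℝ, Γ.IsRational f ∧ ∀ p, (D p : ℝ) = D' p + Γ.ord f p

/-- The complete linear system `|D|`: the effective divisors equivalent to `D`. -/
def linearSystem {V E : Type*} [Fintype E] {Γ : MetricGraph V E} (D : Γ.Divisor) :
    Set Γ.Divisor :=
  {F | 0 ≤ F ∧ LinEquiv F D}

/-- `r` is the rank of `D`, i.e. the minimum of `deg F - 1` over all effective divisors `F` such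
that the linear system of `D - F` is empty. -/
def IsRank {V E : Type*} [Fintype E] {Γ : MetricGraph V E} (D : Γ.Divisor) (r : ℤ) : Prop :=
  IsLeast {n : ℤ | ∃ F : Γ.Divisor, 0 ≤ F ∧ linearSystem (D - F) = ∅ ∧ n = deg F - 1} r

/-- A loop transversal: a set of exactly one interior point of every loop, and no other points. -/
def IsLoopTransversal {V E : Type*} (Γ : MetricGraph V E) (I : Set Γ.Point) : Prop :=
  (∀ p ∈ I, ∃ e, Γ.src e = Γ.tgt e ∧ p ∈ Γ.interior e) ∧
    ∀ e, Γ.src e = Γ.tgt e → ∃! p, p ∈ I ∧ p ∈ Γ.interior e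

/-- A permutation of points of `Γ` with respect to the loop transversal `I`: a finite sequence of
distinct points that contains all the branching points and all the points of `I`. -/
def IsPermutation {V E : Type*} (Γ : MetricGraph V E) (I : Set Γ.Point) (P : List Γ.Point) :
    Prop :=
  P.Nodup ∧ (∀ v, Point.vertex v ∈ P) ∧ ∀ p ∈ I, p ∈ P

open Classical in
/-- The order determined by the sequence `P` on the points that occur in it. -/
def Precedes {V E : Type*} {Γ : MetricGraph V E} (P : List Γ.Point) (p q : Γ.Point) : Prop :=
  p ∈ P ∧ q ∈ P ∧ P.idxOf p < P.idxOf q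

/-- Segments of `Γ`, i.e. subintervals `[a, b]`, `a < b`, of an edge, as triples `(e, a, b)`.
Such a segment is a `P`-segment if both its ends occur in `P` and no point of its interior does. -/
def IsPSegment {V E : Type*} {Γ : MetricGraph V E} (P : List Γ.Point) (L : E × ℝ × ℝ) : Prop :=
  0 ≤ L.2.1 ∧ L.2.1 < L.2.2 ∧ L.2.2 ≤ Γ.len L.1 ∧
    Γ.pt L.1 L.2.1 ∈ P ∧ Γ.pt L.1 L.2.2 ∈ P ∧ ∀ t ∈ Set.Ioo L.2.1 L.2.2, Γ.pt L.1 t ∉ P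

/-- The set of `P`-segments with one end at `p` and the other end preceding `p` in `P`. -/
def segmentsBefore {V E : Type*} {Γ : MetricGraph V E} (P : List Γ.Point) (p : Γ.Point) :
    Set (E × ℝ × ℝ) :=
  {L | IsPSegment P L ∧
    ((Γ.pt L.1 L.2.1 = p ∧ Precedes P (Γ.pt L.1 L.2.2) p) ∨
      (Γ.pt L.1 L.2.2 = p ∧ Precedes P (Γ.pt L.1 L.2.1) p))}

open Classical in
/-- The divisor `ν_P` of a permutation `P`: the coefficient of each `p` in the support of `P` is
the number of `P`-segments from `p` to a preceding point, decreased by one. -/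
noncomputable def nu {V E : Type*} {Γ : MetricGraph V E} (P : List Γ.Point) : Γ.Divisor :=
  ∑ p ∈ P.toFinset, Finsupp.single p (((segmentsBefore P p).ncard : ℤ) - 1)

/-- `(D', P)` is a rank-pair for `D`: `D'` is equivalent to `D` and
`r(D) = deg⁺ (D' - ν_P) - 1`. -/
def IsRankPair {V E : Type*} [Fintype E] {Γ : MetricGraph V E} (D D' : Γ.Divisor)
    (P : List Γ.Point) : Prop :=
  LinEquiv D' D ∧ IsRank D (degPos (D' - nu P) - 1)

end MetricGraph

/-! A divisor below `ν_P` has an empty linear system, by a maximum principle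
(`linearSystem_eq_empty_of_le_nu`). Hence `deg⁺(D' - ν_P) - 1` bounds `r(D)` from above for every
permutation `P` and every `D' ~ D`. What remains is to find one pair that attains the bound and has
a `D'` of the required shape.

Let `F` be effective of least degree with `|D - F| = ∅`. By `exists_reduced_config`, `D - F` is
equivalent to a divisor `R` that is reduced with respect to a vertex `u` and has at most one chip
inside each edge. Emptiness forces a negative coefficient at `u`, so Dhar's fire, started at `u`,
reaches every vertex along edges without chips (`exists_burns_of_linearSystem_eq_empty`). These
edges contain a spanning tree `T`. The burning order, completed by the chips of `R`, is a
permutation with `R ≤ ν_P` (`Burns.exists_permutation`). Since `R + F ~ D` and `R + F - ν_P ≤ F`,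
the bound is attained.

The chips of `F` inside edges still have to be controlled. `exists_end_of_linearSystem_eq_empty`
replaces a chip inside an edge that is not a loop by one at an end, so `F` may be taken on the
vertices and at one interior point of each loop at most. If a loop carries a chip of `F` and a chip
of `R`, the two are merged: one goes to the vertex, the other stays inside. In the symmetric
position both go to the vertex. Then the transversal point of that loop is put at the very beginning
of `P`. Both halves of the loop become segments from the vertex to a preceding point, which pays for
the two chips, and the value `-1` of `ν_P` at the transversal point is made up by a chip of `F'`
there. In all cases `D' = R' + F'` with `R' ≤ ν_P`, `F' ≥ 0` and `deg F' = deg F`. Edges of `T` are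
not loops and carry no chip of either kind. -/

open Set Filter Topology

/-! ### Piecewise linear functions on the line -/

/-- The value at `t` of the piecewise linear function that vanishes near `-∞` and whose slope
increases by `K s` at `s`. -/
noncomputable def hinge (t : ℝ) : (ℝ →₀ ℤ) →+ ℝ :=
  Finsupp.liftAddHom fun s => (AddMonoidHom.mulRight (max 0 (t - s))).comp (Int.castAddHom ℝ)

/-- The slope of `hinge · K` to the right of `t`. -/
noncomputable def slopeRight (t : ℝ) : (ℝ →₀ ℤ) →+ ℤ :=
  Finsupp.liftAddHom fun s => if s ≤ t then AddMonoidHom.id ℤ else 0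

/-- The slope of `hinge · K` to the left of `t`. -/
noncomputable def slopeLeft (t : ℝ) : (ℝ →₀ ℤ) →+ ℤ :=
  Finsupp.liftAddHom fun s => if s < t then AddMonoidHom.id ℤ else 0

/-- The sum of the coefficients. -/
noncomputable def total : (ℝ →₀ ℤ) →+ ℤ :=
  Finsupp.liftAddHom fun _ => AddMonoidHom.id ℤ

@[simp] lemma hinge_single (t s : ℝ) (k : ℤ) :
    hinge t (Finsupp.single s k) = k * max 0 (t - s) := by simp [hinge]

@[simp] lemma slopeRight_single (t s : ℝ) (k : ℤ) :
    slopeRight t (Finsupp.single s k) = if s ≤ t then k else 0 := by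
  simp only [slopeRight, Finsupp.liftAddHom_apply_single]; split_ifs <;> rfl

@[simp] lemma slopeLeft_single (t s : ℝ) (k : ℤ) :
    slopeLeft t (Finsupp.single s k) = if s < t then k else 0 := by
  simp only [slopeLeft, Finsupp.liftAddHom_apply_single]; split_ifs <;> rfl

@[simp] lemma total_single (s : ℝ) (k : ℤ) : total (Finsupp.single s k) = k := by simp [total]

lemma hinge_eq_sum (t : ℝ) (K : ℝ →₀ ℤ) :
    hinge t K = ∑ s ∈ K.support, (K s : ℝ) * max 0 (t - s) := by
  simp [hinge, Finsupp.liftAddHom_apply, Finsupp.sum]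

lemma slopeRight_eq_sum (t : ℝ) (K : ℝ →₀ ℤ) :
    slopeRight t K = ∑ s ∈ K.support, if s ≤ t then K s else 0 := by
  simp only [slopeRight, Finsupp.liftAddHom_apply, Finsupp.sum]
  exact Finset.sum_congr rfl fun s _ => by split_ifs <;> rfl

lemma slopeLeft_eq_sum (t : ℝ) (K : ℝ →₀ ℤ) :
    slopeLeft t K = ∑ s ∈ K.support, if s < t then K s else 0 := by
  simp only [slopeLeft, Finsupp.liftAddHom_apply, Finsupp.sum]
  exact Finset.sum_congr rfl fun s _ => by split_ifs <;> rfl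

lemma total_eq_sum (K : ℝ →₀ ℤ) : total K = ∑ s ∈ K.support, K s := by
  simp [total, Finsupp.liftAddHom_apply, Finsupp.sum]

lemma slopeRight_sub_slopeLeft (t : ℝ) (K : ℝ →₀ ℤ) : slopeRight t K - slopeLeft t K = K t := by
  induction K using Finsupp.induction_linear with
  | zero => simp
  | add f g hf hg => simp only [map_add, Finsupp.add_apply, ← hf, ← hg]; ring
  | single s k =>
    simp only [slopeRight_single, slopeLeft_single, Finsupp.single_apply]
    rcases lt_trichotomy s t with h | h | h
    · simp [h, h.le, h.ne]
    · simp [h]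
    · simp [h.not_ge, h.not_gt, h.ne']

lemma hinge_of_nonpos {K : ℝ →₀ ℤ} {t : ℝ} (h : ∀ s ∈ K.support, t ≤ s) : hinge t K = 0 := by
  rw [hinge_eq_sum]
  refine Finset.sum_eq_zero fun s hs => ?_
  rw [max_eq_left (by linarith [h s hs]), mul_zero]

lemma slopeRight_of_lt {K : ℝ →₀ ℤ} {t : ℝ} (h : ∀ s ∈ K.support, t < s) :
    slopeRight t K = 0 := by
  rw [slopeRight_eq_sum]
  exact Finset.sum_eq_zero fun s hs => by rw [if_neg (h s hs).not_ge]

lemma slopeLeft_of_lt {K : ℝ →₀ ℤ} {t : ℝ} (h : ∀ s ∈ K.support, s < t) :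
    slopeLeft t K = total K := by
  rw [slopeLeft_eq_sum, total_eq_sum]
  exact Finset.sum_congr rfl fun s hs => by rw [if_pos (h s hs)]

lemma hinge_eq_total {K : ℝ →₀ ℤ} {t : ℝ} (h : ∀ s ∈ K.support, s ≤ t) :
    hinge t K = total K * t - ∑ s ∈ K.support, (K s : ℝ) * s := by
  rw [hinge_eq_sum, total_eq_sum, Int.cast_sum, Finset.sum_mul, ← Finset.sum_sub_distrib]
  refine Finset.sum_congr rfl fun s hs => ?_
  rw [max_eq_right (by linarith [h s hs])]; ring

lemma hinge_linear {K : ℝ →₀ ℤ} {a t : ℝ} (hat : a ≤ t) (h : ∀ s ∈ K.support, s ∉ Ioo a t) :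
    hinge t K = hinge a K + slopeRight a K * (t - a) := by
  rw [hinge_eq_sum, hinge_eq_sum, slopeRight_eq_sum, Int.cast_sum, Finset.sum_mul,
    ← Finset.sum_add_distrib]
  refine Finset.sum_congr rfl fun s hs => ?_
  have := h s hs
  split_ifs with hsa
  · rw [max_eq_right (by linarith), max_eq_right (by linarith)]; ring
  · have hts : t ≤ s := by
      by_contra hc; exact this ⟨not_le.1 hsa, not_le.1 hc⟩
    rw [max_eq_left (by linarith), max_eq_left (by linarith)]; simp

/-- Convexity: the slope does not decrease inside the interval, so the graph lies above its tangent
at `a`. `hinge_le_left` uses the tangent at `b`. -/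
lemma hinge_le_right {K : ℝ →₀ ℤ} {a b : ℝ} (hab : a ≤ b) (h : ∀ s ∈ Ioo a b, 0 ≤ K s) :
    hinge a K + slopeRight a K * (b - a) ≤ hinge b K := by
  rw [hinge_eq_sum, hinge_eq_sum, slopeRight_eq_sum, Int.cast_sum, Finset.sum_mul,
    ← Finset.sum_add_distrib]
  refine Finset.sum_le_sum fun s hs => ?_
  split_ifs with hsa
  · rw [max_eq_right (by linarith), max_eq_right (by linarith)]; exact le_of_eq (by ring)
  · rcases le_or_gt b s with hb | hb
    · rw [max_eq_left (by linarith), max_eq_left (by linarith)]; simp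
    · have : (0 : ℝ) ≤ K s := by exact_mod_cast h s ⟨not_le.1 hsa, hb⟩
      rw [max_eq_left (by linarith), max_eq_right (by linarith)]
      simp only [mul_zero, Int.cast_zero, zero_mul, add_zero]
      exact mul_nonneg this (by linarith)

lemma hinge_le_left {K : ℝ →₀ ℤ} {a b : ℝ} (hab : a ≤ b) (h : ∀ s ∈ Ioo a b, 0 ≤ K s) :
    hinge b K ≤ hinge a K + slopeLeft b K * (b - a) := by
  rw [hinge_eq_sum, hinge_eq_sum, slopeLeft_eq_sum, Int.cast_sum, Finset.sum_mul,
    ← Finset.sum_add_distrib]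
  refine Finset.sum_le_sum fun s hs => ?_
  split_ifs with hsb
  · rcases le_or_gt s a with ha | ha
    · rw [max_eq_right (by linarith), max_eq_right (by linarith)]; exact le_of_eq (by ring)
    · have : (0 : ℝ) ≤ K s := by exact_mod_cast h s ⟨ha, hsb⟩
      rw [max_eq_right (by linarith), max_eq_left (by linarith)]
      simp only [mul_zero, zero_add]
      exact mul_le_mul_of_nonneg_left (by linarith) this
  · rw [max_eq_left (by linarith), max_eq_left (by linarith)]; simp

lemma hasDerivWithinAt_hinge_Ioi (K : ℝ →₀ ℤ) (t : ℝ) :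
    HasDerivWithinAt (fun x => hinge x K) (slopeRight t K) (Ioi t) t := by
  have hfin : ∃ b > t, ∀ s ∈ K.support, s ∉ Ioo t b := by
    have : ∀ᶠ b in 𝓝[>] t, ∀ s ∈ K.support, s ∉ Ioo t b := by
      rw [Finset.eventually_all]
      intro s _
      rcases le_or_gt s t with h | h
      · exact Eventually.of_forall fun b hb => hb.1.not_ge h
      · filter_upwards [Ioo_mem_nhdsGT h] with b hb hs using hs.2.not_gt hb.2
    obtain ⟨b, hb, hb'⟩ := (this.and self_mem_nhdsWithin).exists
    exact ⟨b, hb', hb⟩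
  obtain ⟨b, hb, hs⟩ := hfin
  have h1 : HasDerivWithinAt (fun x => hinge t K + slopeRight t K * (x - t))
      (slopeRight t K) (Ioi t) t := by
    simpa using ((((hasDerivAt_id t).sub_const t).const_mul (slopeRight t K : ℝ)).const_add
      (hinge t K)).hasDerivWithinAt (s := Ioi t)
  refine h1.congr_of_eventuallyEq ?_ (by simp)
  filter_upwards [Ioo_mem_nhdsGT hb] with x hx
  exact hinge_linear hx.1.le fun s hsK hsx => hs s hsK ⟨hsx.1, hsx.2.trans hx.2⟩

lemma hasDerivWithinAt_hinge_Iio (K : ℝ →₀ ℤ) (t : ℝ) :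
    HasDerivWithinAt (fun x => hinge x K) (slopeLeft t K) (Iio t) t := by
  have hfin : ∃ a < t, ∀ s ∈ K.support, s ∉ Ico a t := by
    have : ∀ᶠ a in 𝓝[<] t, ∀ s ∈ K.support, s ∉ Ico a t := by
      rw [Finset.eventually_all]
      intro s _
      rcases le_or_gt t s with h | h
      · exact Eventually.of_forall fun b hb => hb.2.not_ge h
      · filter_upwards [Ioo_mem_nhdsLT h] with b hb hs using hs.1.not_gt hb.1
    obtain ⟨b, hb, hb'⟩ := (this.and self_mem_nhdsWithin).exists
    exact ⟨b, hb', hb⟩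
  obtain ⟨a, ha, hs⟩ := hfin
  have hsl : ∀ x ∈ Ico a t, slopeRight x K = slopeLeft t K := by
    intro x hx
    rw [slopeRight_eq_sum, slopeLeft_eq_sum]
    refine Finset.sum_congr rfl fun s hsK => ?_
    have := hs s hsK
    by_cases h : s ≤ x
    · rw [if_pos h, if_pos (h.trans_lt hx.2)]
    · rw [if_neg h, if_neg fun h' => this ⟨hx.1.trans (not_le.1 h).le, h'⟩]
  have h1 : HasDerivWithinAt (fun x => hinge t K + slopeLeft t K * (x - t))
      (slopeLeft t K) (Iio t) t := by
    simpa using ((((hasDerivAt_id t).sub_const t).const_mul (slopeLeft t K : ℝ)).const_add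
      (hinge t K)).hasDerivWithinAt (s := Iio t)
  refine h1.congr_of_eventuallyEq ?_ (by simp)
  filter_upwards [Ioo_mem_nhdsLT ha] with x hx
  have := hinge_linear (K := K) hx.2.le fun s hsK hsx => hs s hsK ⟨hx.1.le.trans hsx.1.le, hsx.2⟩
  rw [this, hsl x ⟨hx.1.le, hx.2⟩]; ring

lemma continuous_hinge (K : ℝ →₀ ℤ) : Continuous fun t => hinge t K := by
  simp only [hinge_eq_sum]; fun_prop

/-- A continuous function on `[0, L]` with finitely many linear parts of integral slope. -/
theorem exists_hinge_of_piecewise (S : Finset ℝ) (f : ℝ → ℝ) : ∀ (n : ℕ) (L : ℝ), 0 < L →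
    (S.filter (· ∈ Ioo 0 L)).card ≤ n → ContinuousOn f (Icc 0 L) →
    (∀ a b : ℝ, 0 ≤ a → a < b → b ≤ L → (∀ s ∈ S, s ∉ Ioo a b) →
      ∃ (m : ℤ) (c : ℝ), ∀ t ∈ Ioo a b, f t = m * t + c) →
    ∃ (c : ℝ) (m : ℤ) (K : ℝ →₀ ℤ), (∀ s ∈ K.support, s ∈ Ioo 0 L) ∧
      ∀ t ∈ Icc 0 L, f t = c + m * t + hinge t K := by
  have closed : ∀ (a b : ℝ), a < b → ContinuousOn f (Icc a b) →
      (∃ (m : ℤ) (c : ℝ), ∀ t ∈ Ioo a b, f t = m * t + c) →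
      ∃ (m : ℤ) (c : ℝ), ∀ t ∈ Icc a b, f t = m * t + c := by
    rintro a b hab hc ⟨m, c, h⟩
    refine ⟨m, c, ?_⟩
    exact Set.EqOn.of_subset_closure (f := f) (g := fun t => (m : ℝ) * t + c) h hc
      (by fun_prop) Ioo_subset_Icc_self (by rw [closure_Ioo hab.ne])
  intro n
  induction n with
  | zero =>
    intro L hL hcard hc hp
    have hemp : ∀ s ∈ S, s ∉ Ioo 0 L := by
      intro s hs hs'
      have := Finset.card_eq_zero.1 (Nat.le_zero.1 hcard)
      exact Finset.notMem_empty s (this ▸ Finset.mem_filter.2 ⟨hs, hs'⟩)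
    obtain ⟨m, c, h⟩ := closed 0 L hL hc (hp 0 L le_rfl hL le_rfl hemp)
    exact ⟨c, m, 0, by simp, fun t ht => by rw [h t ht]; simp; ring⟩
  | succ n ih =>
    intro L hL hcard hc hp
    by_cases hne : (S.filter (· ∈ Ioo 0 L)).Nonempty
    -- Splitting at the last breakpoint leaves a single linear piece to its right.
    · set s := (S.filter (· ∈ Ioo 0 L)).max' hne with hsdef
      have hsm := Finset.max'_mem _ hne
      rw [← hsdef, Finset.mem_filter] at hsm
      obtain ⟨hsS, hs0, hsL⟩ := hsm
      have hmax : ∀ x ∈ S, x ∉ Ioo s L := fun x hx hx' =>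
        (Finset.le_max' _ x (Finset.mem_filter.2 ⟨hx, hs0.trans hx'.1, hx'.2⟩)).not_gt hx'.1
      have hlt : (S.filter (· ∈ Ioo 0 s)).card ≤ n := by
        have : (S.filter (· ∈ Ioo 0 s)).card < (S.filter (· ∈ Ioo 0 L)).card := by
          refine Finset.card_lt_card (Finset.ssubset_iff_of_subset ?_ |>.2 ⟨s, ?_, ?_⟩)
          · intro x hx
            rw [Finset.mem_filter] at hx ⊢
            exact ⟨hx.1, hx.2.1, hx.2.2.trans hsL⟩
          · exact Finset.mem_filter.2 ⟨hsS, hs0, hsL⟩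
          · simp
        omega
      obtain ⟨c, m, K, hK, hf⟩ := ih s hs0 hlt (hc.mono (Icc_subset_Icc_right hsL.le))
        fun a b ha hab hb => hp a b ha hab (hb.trans hsL.le)
      obtain ⟨m', c', hf'⟩ := closed s L hsL (hc.mono (Icc_subset_Icc_left hs0.le))
        (hp s L hs0.le hsL le_rfl hmax)
      -- All of `K` lies to the left of `s`, so the slope just before `s` is `m + total K`; the new
      -- coefficient is the jump to `m'`.
      refine ⟨c, m, K + Finsupp.single s (m' - (m + total K)), ?_, fun t ht => ?_⟩
      · intro x hx
        rcases Finset.mem_union.1 (Finsupp.support_add hx) with h | h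
        · exact ⟨(hK x h).1, (hK x h).2.trans hsL⟩
        · rw [Finset.mem_singleton.1 (Finsupp.support_single_subset h)]; exact ⟨hs0, hsL⟩
      · rw [map_add, hinge_single]
        rcases le_total t s with h | h
        · rw [max_eq_left (by linarith), hf t ⟨ht.1, h⟩]; ring
        · have h1 := hf s ⟨hs0.le, le_rfl⟩
          have h2 := hf' s ⟨le_rfl, hsL.le⟩
          rw [hf' t ⟨h, ht.2⟩, max_eq_right (by linarith)]
          have h3 := hinge_eq_total (K := K) (t := t) fun x hx => (hK x hx).2.le.trans h
          have h4 := hinge_eq_total (K := K) (t := s) fun x hx => (hK x hx).2.le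
          push_cast
          rw [h3]; rw [h4] at h1
          linear_combination h1 - h2
    · rw [Finset.not_nonempty_iff_eq_empty] at hne
      exact ih L hL (by rw [hne]; simp) hc hp

namespace MetricGraph

/-! ### Points of an edge, and the part of a divisor inside an edge -/

section Parametrization

variable {V E : Type*} (Γ : MetricGraph V E)

lemma pt_of_mem {e : E} {t : ℝ} (h : t ∈ Ioo 0 (Γ.len e)) : Γ.pt e t = .inner e ⟨t, h⟩ := by
  simp only [pt, dif_pos h]

lemma pt_of_nonpos {e : E} {t : ℝ} (h : t ≤ 0) : Γ.pt e t = .vertex (Γ.src e) := by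
  have : t ∉ Ioo 0 (Γ.len e) := fun h' => h'.1.not_ge h
  simp only [pt, dif_neg this, if_pos h]

lemma pt_of_len_le {e : E} {t : ℝ} (h : Γ.len e ≤ t) : Γ.pt e t = .vertex (Γ.tgt e) := by
  have h1 : t ∉ Ioo 0 (Γ.len e) := fun h' => h'.2.not_ge h
  have h2 : ¬ t ≤ 0 := ((Γ.len_pos e).trans_le h).not_ge
  simp only [pt, dif_neg h1, if_neg h2]

lemma pt_zero (e : E) : Γ.pt e 0 = .vertex (Γ.src e) := Γ.pt_of_nonpos le_rfl

lemma pt_len (e : E) : Γ.pt e (Γ.len e) = .vertex (Γ.tgt e) := Γ.pt_of_len_le le_rfl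

lemma inner_eq_pt (e : E) (t : Ioo (0 : ℝ) (Γ.len e)) : Point.inner e t = Γ.pt e t := by
  rw [Γ.pt_of_mem t.2]

lemma pt_eq_inner_iff {e e' : E} {s : ℝ} {t : Ioo (0 : ℝ) (Γ.len e)} :
    Γ.pt e' s = .inner e t ↔ e' = e ∧ s = t := by
  constructor
  · intro h
    unfold pt at h
    split_ifs at h with h1 h2
    injection h with h3 h4
    subst h3
    exact ⟨rfl, congrArg Subtype.val (eq_of_heq h4)⟩
  · rintro ⟨rfl, rfl⟩
    rw [inner_eq_pt]

lemma pt_eq_vertex_iff {e : E} {s : ℝ} {v : V} :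
    Γ.pt e s = .vertex v ↔ (s ≤ 0 ∧ Γ.src e = v) ∨ (Γ.len e ≤ s ∧ Γ.tgt e = v) := by
  rcases le_or_gt s 0 with h | h
  · rw [Γ.pt_of_nonpos h]
    have := (h.trans_lt (Γ.len_pos e)).not_ge
    simp [h, this]
  · rcases le_or_gt (Γ.len e) s with h' | h'
    · rw [Γ.pt_of_len_le h']
      simp [h.not_ge, h']
    · rw [Γ.pt_of_mem ⟨h, h'⟩]
      simp [h.not_ge, h'.not_ge]

end Parametrization

section Restriction

variable {V E : Type*} {Γ : MetricGraph V E}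

open Classical in
/-- The part of a divisor in the interior of the edge `e`, as a divisor on `ℝ`. -/
noncomputable def restr (e : E) : Γ.Divisor →+ (ℝ →₀ ℤ) :=
  Finsupp.liftAddHom fun p => match p with
    | .vertex _ => 0
    | .inner e' t => if e' = e then Finsupp.singleAddHom (t : ℝ) else 0

@[simp] lemma restr_single_vertex (e : E) (v : V) (k : ℤ) :
    restr e (Finsupp.single (.vertex v : Γ.Point) k) = 0 := by
  simp [restr]

open Classical in
@[simp] lemma restr_single_inner (e e' : E) (t : Ioo (0 : ℝ) (Γ.len e')) (k : ℤ) :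
    restr e (Finsupp.single (.inner e' t : Γ.Point) k) =
      if e' = e then Finsupp.single (t : ℝ) k else 0 := by
  simp only [restr, Finsupp.liftAddHom_apply_single]
  split_ifs <;> simp

lemma restr_apply (e : E) (D : Γ.Divisor) (s : Ioo (0 : ℝ) (Γ.len e)) :
    restr e D s = D (.inner e s) := by
  classical
  induction D using Finsupp.induction_linear with
  | zero => simp
  | add f g hf hg => simp [hf, hg]
  | single p k =>
    cases p with
    | vertex v => simp
    | inner e' t =>
      rw [restr_single_inner]
      by_cases h : e' = e
      · subst h
        simp [Finsupp.single_apply, Subtype.ext_iff]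
      · simp [h]

lemma restr_eq_zero (e : E) (D : Γ.Divisor) {s : ℝ} (hs : s ∉ Ioo 0 (Γ.len e)) :
    restr e D s = 0 := by
  classical
  induction D using Finsupp.induction_linear with
  | zero => simp
  | add f g hf hg => simp [hf, hg]
  | single p k =>
    cases p with
    | vertex v => simp
    | inner e' t =>
      rw [restr_single_inner]
      by_cases h : e' = e
      · subst h
        have : (t : ℝ) ≠ s := fun h => hs (h ▸ t.2)
        simp [this]
      · simp [h]

lemma mem_of_mem_support_restr {e : E} {D : Γ.Divisor} {s : ℝ} (hs : s ∈ (restr e D).support) :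
    s ∈ Ioo 0 (Γ.len e) := by
  by_contra h
  exact Finsupp.mem_support_iff.1 hs (restr_eq_zero e D h)

end Restriction

/-! ### Principal divisors and linear equivalence -/

section RationalFunctions

variable {V E : Type*} {Γ : MetricGraph V E}

lemma slopeForward_eq {f : Γ.Point → ℝ} {e : E} {c : ℝ} {m : ℤ} {K : ℝ →₀ ℤ}
    (h : ∀ t ∈ Icc 0 (Γ.len e), f (Γ.pt e t) = c + m * t + hinge t K) {t : ℝ}
    (ht : t ∈ Ico 0 (Γ.len e)) : Γ.slopeForward f e t = m + slopeRight t K := by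
  unfold slopeForward
  have h1 : HasDerivWithinAt (fun x : ℝ => c + m * x + hinge x K) (m + slopeRight t K)
      (Ioi t) t := by
    have := (((hasDerivAt_id t).const_mul (m : ℝ)).const_add c).hasDerivWithinAt (s := Ioi t)
    simpa [Pi.add_def] using this.add (hasDerivWithinAt_hinge_Ioi K t)
  have h2 : HasDerivWithinAt (fun x => f (Γ.pt e x)) (m + slopeRight t K) (Ioi t) t := by
    refine h1.congr_of_eventuallyEq ?_ (h t ⟨ht.1, ht.2.le⟩)
    filter_upwards [Ioo_mem_nhdsGT ht.2] with x hx
    exact h x ⟨ht.1.trans hx.1.le, hx.2.le⟩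
  exact h2.derivWithin (uniqueDiffWithinAt_Ioi t)

lemma slopeBackward_eq {f : Γ.Point → ℝ} {e : E} {c : ℝ} {m : ℤ} {K : ℝ →₀ ℤ}
    (h : ∀ t ∈ Icc 0 (Γ.len e), f (Γ.pt e t) = c + m * t + hinge t K) {t : ℝ}
    (ht : t ∈ Ioc 0 (Γ.len e)) : Γ.slopeBackward f e t = -(m + slopeLeft t K) := by
  unfold slopeBackward
  have h1 : HasDerivWithinAt (fun x : ℝ => c + m * x + hinge x K) (m + slopeLeft t K)
      (Iio t) t := by
    have := (((hasDerivAt_id t).const_mul (m : ℝ)).const_add c).hasDerivWithinAt (s := Iio t)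
    simpa [Pi.add_def] using this.add (hasDerivWithinAt_hinge_Iio K t)
  have h2 : HasDerivWithinAt (fun x => f (Γ.pt e x)) (m + slopeLeft t K) (Iio t) t := by
    refine h1.congr_of_eventuallyEq ?_ (h t ⟨ht.1.le, ht.2⟩)
    filter_upwards [Ioo_mem_nhdsLT ht.1] with x hx
    exact h x ⟨hx.1.le, hx.2.le.trans ht.2⟩
  rw [h2.derivWithin (uniqueDiffWithinAt_Iio t)]

lemma IsRational.exists_hinge {f : Γ.Point → ℝ} (hf : Γ.IsRational f) (e : E) :
    ∃ (c : ℝ) (m : ℤ) (K : ℝ →₀ ℤ), (∀ s ∈ K.support, s ∈ Ioo 0 (Γ.len e)) ∧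
      ∀ t ∈ Icc 0 (Γ.len e), f (Γ.pt e t) = c + m * t + hinge t K := by
  obtain ⟨hc, S, hS⟩ := hf e
  exact exists_hinge_of_piecewise S _ _ _ (Γ.len_pos e) le_rfl hc hS

lemma isRational_of_hinge {f : Γ.Point → ℝ} (h : ∀ e, ∃ (c : ℝ) (m : ℤ) (K : ℝ →₀ ℤ),
    ∀ t ∈ Icc 0 (Γ.len e), f (Γ.pt e t) = c + m * t + hinge t K) : Γ.IsRational f := by
  intro e
  obtain ⟨c, m, K, hK⟩ := h e
  refine ⟨?_, K.support, fun a b ha hab hb hS => ?_⟩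
  · have := continuous_hinge K
    exact ContinuousOn.congr (f := fun t : ℝ => c + m * t + hinge t K) (by fun_prop) hK
  · refine ⟨m + slopeRight a K, c + hinge a K - slopeRight a K * a, fun t ht => ?_⟩
    rw [hK t ⟨ha.trans ht.1.le, ht.2.le.trans hb⟩,
      hinge_linear ht.1.le fun s hs hst => hS s hs ⟨hst.1, hst.2.trans ht.2⟩]
    push_cast; ring

lemma deg_add (A B : Γ.Divisor) : deg (A + B) = deg A + deg B :=
  Finsupp.sum_add_index' (fun _ => rfl) fun _ _ _ => rfl

lemma deg_single (p : Γ.Point) (k : ℤ) : deg (Finsupp.single p k) = k :=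
  Finsupp.sum_single_index rfl

lemma deg_zero : deg (0 : Γ.Divisor) = 0 := rfl

lemma deg_neg (A : Γ.Divisor) : deg (-A) = -deg A := by
  have := deg_add A (-A)
  rw [add_neg_cancel, deg_zero] at this; omega

lemma deg_sub (A B : Γ.Divisor) : deg (A - B) = deg A - deg B := by
  rw [sub_eq_add_neg, deg_add, deg_neg]; ring

lemma deg_sum {ι : Type*} (s : Finset ι) (A : ι → Γ.Divisor) :
    deg (∑ i ∈ s, A i) = ∑ i ∈ s, deg (A i) := by
  classical
  induction s using Finset.induction_on with
  | empty => simp [deg_zero]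
  | insert i s hi ih => rw [Finset.sum_insert hi, Finset.sum_insert hi, deg_add, ih]

lemma deg_nonneg {A : Γ.Divisor} (h : 0 ≤ A) : 0 ≤ deg A :=
  Finset.sum_nonneg fun p _ => h p

variable [Fintype E]

open Classical in
/-- The divisors of rational functions, in terms of the values `φ` at the vertices and the slopes
`m` at the sources of the edges. -/
def IsPrincipal (Δ : Γ.Divisor) : Prop :=
  ∃ (φ : V → ℝ) (m : E → ℤ),
    (∀ e, φ (Γ.tgt e) = φ (Γ.src e) + m e * Γ.len e + hinge (Γ.len e) (restr e Δ)) ∧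
    ∀ v, Δ (.vertex v) = ∑ e, ((if Γ.src e = v then m e else 0) -
      (if Γ.tgt e = v then m e + total (restr e Δ) else 0))

/-- At an interior point the order of `f` is the jump of its slope, which is the coefficient in the
hinge expansion. So the divisor determines `f` on an edge up to the value and the slope at the
source. -/
lemma exists_hinge_restr {f : Γ.Point → ℝ} (hf : Γ.IsRational f) {Δ : Γ.Divisor}
    (hΔ : ∀ p, (Δ p : ℝ) = Γ.ord f p) (e : E) : ∃ m : ℤ, ∀ t ∈ Icc 0 (Γ.len e),
      f (Γ.pt e t) = f (.vertex (Γ.src e)) + m * t + hinge t (restr e Δ) := by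
  obtain ⟨c, m, K, hK, h⟩ := hf.exists_hinge e
  have hKΔ : K = restr e Δ := by
    ext s
    by_cases hs : s ∈ Ioo 0 (Γ.len e)
    · have h1 := hΔ (.inner e ⟨s, hs⟩)
      simp only [ord] at h1
      rw [slopeForward_eq h ⟨hs.1.le, hs.2⟩, slopeBackward_eq h ⟨hs.1, hs.2.le⟩] at h1
      rw [← slopeRight_sub_slopeLeft s K]
      have h2 := restr_apply e Δ ⟨s, hs⟩
      simp only at h2
      rw [h2]
      have : ((slopeRight s K - slopeLeft s K : ℤ) : ℝ) = Δ (.inner e ⟨s, hs⟩) := by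
        rw [h1]; push_cast; ring
      exact_mod_cast this
    · rw [restr_eq_zero e Δ hs]
      by_contra hne
      exact hs (hK s (Finsupp.mem_support_iff.2 hne))
  subst hKΔ
  refine ⟨m, fun t ht => ?_⟩
  have h0 := h 0 ⟨le_rfl, (Γ.len_pos e).le⟩
  rw [pt_zero, hinge_of_nonpos fun s hs => (hK s hs).1.le] at h0
  rw [h t ht, h0]; ring

/-- The expansion on an edge, evaluated at the target, gives the first condition; its outgoing
slopes `m e` and `-(m e + total)` at the two ends give the second. With the converse
`IsPrincipal.exists_ord`, derivatives disappear from linear equivalence. -/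
theorem isPrincipal_of_ord {f : Γ.Point → ℝ} (hf : Γ.IsRational f) {Δ : Γ.Divisor}
    (hΔ : ∀ p, (Δ p : ℝ) = Γ.ord f p) : IsPrincipal Δ := by
  choose m hm using exists_hinge_restr hf hΔ
  refine ⟨fun v => f (.vertex v), m, fun e => ?_, fun v => ?_⟩
  · rw [← hm e _ ⟨(Γ.len_pos e).le, le_rfl⟩, pt_len]
  · classical
    have h := hΔ (.vertex v)
    simp only [ord] at h
    have : (Δ (.vertex v) : ℝ) = ((∑ e, ((if Γ.src e = v then m e else 0) -
      (if Γ.tgt e = v then m e + total (restr e Δ) else 0)) : ℤ) : ℝ) := by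
      rw [h, Int.cast_sum]
      refine Finset.sum_congr rfl fun e _ => ?_
      rw [slopeForward_eq (hm e) ⟨le_rfl, Γ.len_pos e⟩,
        slopeBackward_eq (hm e) ⟨Γ.len_pos e, le_rfl⟩,
        slopeRight_of_lt fun s hs => (mem_of_mem_support_restr hs).1,
        slopeLeft_of_lt fun s hs => (mem_of_mem_support_restr hs).2]
      push_cast
      split_ifs <;> simp
    exact_mod_cast this

theorem IsPrincipal.exists_ord {Δ : Γ.Divisor} (h : IsPrincipal Δ) :
    ∃ f : Γ.Point → ℝ, Γ.IsRational f ∧ ∀ p, (Δ p : ℝ) = Γ.ord f p := by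
  obtain ⟨φ, m, h1, h2⟩ := h
  let f : Γ.Point → ℝ := fun p => match p with
    | .vertex v => φ v
    | .inner e t => φ (Γ.src e) + m e * t + hinge t (restr e Δ)
  have hf : ∀ e, ∀ t ∈ Icc 0 (Γ.len e),
      f (Γ.pt e t) = φ (Γ.src e) + m e * t + hinge t (restr e Δ) := by
    intro e t ht
    rcases ht.1.eq_or_lt with h | h
    · rw [← h, pt_zero, hinge_of_nonpos fun s hs => (mem_of_mem_support_restr hs).1.le]
      simp [f]
    · rcases ht.2.eq_or_lt with h' | h'
      · rw [h', pt_len, ← h1]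
      · rw [Γ.pt_of_mem ⟨h, h'⟩]
  refine ⟨f, isRational_of_hinge fun e => ⟨_, _, _, hf e⟩, fun p => ?_⟩
  cases p with
  | vertex v =>
    rw [h2 v, ord, Int.cast_sum]
    refine Finset.sum_congr rfl fun e _ => ?_
    rw [slopeForward_eq (hf e) ⟨le_rfl, Γ.len_pos e⟩,
      slopeBackward_eq (hf e) ⟨Γ.len_pos e, le_rfl⟩,
      slopeRight_of_lt fun s hs => (mem_of_mem_support_restr hs).1,
      slopeLeft_of_lt fun s hs => (mem_of_mem_support_restr hs).2]
    push_cast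
    split_ifs <;> simp
  | inner e t =>
    rw [ord, slopeForward_eq (hf e) ⟨t.2.1.le, t.2.2⟩, slopeBackward_eq (hf e) ⟨t.2.1, t.2.2.le⟩,
      ← restr_apply, ← slopeRight_sub_slopeLeft]
    push_cast; ring

theorem linEquiv_iff {D D' : Γ.Divisor} : LinEquiv D D' ↔ IsPrincipal (D - D') := by
  constructor
  · rintro ⟨f, hf, h⟩
    exact isPrincipal_of_ord hf fun p => by rw [Finsupp.sub_apply, Int.cast_sub, h p]; ring
  · intro h
    obtain ⟨f, hf, h⟩ := h.exists_ord
    refine ⟨f, hf, fun p => ?_⟩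
    rw [← h p, Finsupp.sub_apply, Int.cast_sub]; ring

lemma isPrincipal_zero : IsPrincipal (0 : Γ.Divisor) :=
  ⟨0, 0, by simp, by simp⟩

lemma IsPrincipal.add {A B : Γ.Divisor} (hA : IsPrincipal A) (hB : IsPrincipal B) :
    IsPrincipal (A + B) := by
  obtain ⟨φ, m, h1, h2⟩ := hA
  obtain ⟨ψ, k, h3, h4⟩ := hB
  refine ⟨φ + ψ, m + k, fun e => ?_, fun v => ?_⟩
  · simp only [Pi.add_apply, map_add, h1 e, h3 e]; push_cast; ring
  · rw [Finsupp.add_apply, h2, h4, ← Finset.sum_add_distrib]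
    refine Finset.sum_congr rfl fun e _ => ?_
    simp only [Pi.add_apply, map_add]
    split_ifs <;> ring

lemma IsPrincipal.neg {A : Γ.Divisor} (hA : IsPrincipal A) : IsPrincipal (-A) := by
  obtain ⟨φ, m, h1, h2⟩ := hA
  refine ⟨-φ, -m, fun e => ?_, fun v => ?_⟩
  · simp only [Pi.neg_apply, map_neg, h1 e]; push_cast; ring
  · rw [Finsupp.neg_apply, h2, ← Finset.sum_neg_distrib]
    refine Finset.sum_congr rfl fun e _ => ?_
    simp only [Pi.neg_apply, map_neg]
    split_ifs <;> ring

lemma LinEquiv.refl (D : Γ.Divisor) : LinEquiv D D := by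
  rw [linEquiv_iff, sub_self]; exact isPrincipal_zero

lemma LinEquiv.symm {A B : Γ.Divisor} (h : LinEquiv A B) : LinEquiv B A := by
  rw [linEquiv_iff] at *; simpa using h.neg

lemma LinEquiv.trans {A B C : Γ.Divisor} (h : LinEquiv A B) (h' : LinEquiv B C) :
    LinEquiv A C := by
  rw [linEquiv_iff] at *; simpa using h.add h'

lemma LinEquiv.add {A B C D : Γ.Divisor} (h : LinEquiv A B) (h' : LinEquiv C D) :
    LinEquiv (A + C) (B + D) := by
  rw [linEquiv_iff] at *; convert h.add h' using 1; abel

lemma LinEquiv.neg {A B : Γ.Divisor} (h : LinEquiv A B) : LinEquiv (-A) (-B) := by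
  rw [linEquiv_iff] at *; convert h.neg using 1; abel

lemma LinEquiv.sub {A B C D : Γ.Divisor} (h : LinEquiv A B) (h' : LinEquiv C D) :
    LinEquiv (A - C) (B - D) := by
  rw [sub_eq_add_neg, sub_eq_add_neg]; exact h.add h'.neg

lemma LinEquiv.linearSystem_eq {A B : Γ.Divisor} (h : LinEquiv A B) :
    linearSystem A = linearSystem B := by
  ext F
  exact and_congr_right fun _ => ⟨fun h' => h'.trans h, fun h' => h'.trans h.symm⟩

lemma deg_eq_sum [Fintype V] (D : Γ.Divisor) :
    deg D = ∑ v, D (.vertex v) + ∑ e, total (restr e D) := by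
  classical
  induction D using Finsupp.induction_linear with
  | zero => simp [deg_zero]
  | add f g hf hg =>
    rw [deg_add, hf, hg]; simp only [map_add, Finsupp.add_apply, Finset.sum_add_distrib]; ring
  | single p k =>
    rw [deg_single]
    cases p with
    | vertex v => simp [Finsupp.single_apply]
    | inner e t => simp [apply_ite total]

/-- Each edge contributes `m` at its source, `-(m + total)` at its target and `total` in its
interior. -/
lemma LinEquiv.deg_eq [Finite V] {A B : Γ.Divisor} (h : LinEquiv A B) : deg A = deg B := by
  classical
  cases nonempty_fintype V
  obtain ⟨φ, m, -, h2⟩ := linEquiv_iff.1 h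
  have : deg (A - B) = 0 := by
    rw [deg_eq_sum, Finset.sum_congr rfl fun v _ => h2 v, Finset.sum_comm,
      ← Finset.sum_add_distrib]
    exact Finset.sum_eq_zero fun e _ => by simp
  rw [deg_sub] at this; omega

end RationalFunctions

end MetricGraph

namespace MetricGraph

/-! ### Segments of a permutation, and directions at a point -/

section Segments

variable {V E : Type*} {Γ : MetricGraph V E}

lemma nu_apply (P : List Γ.Point) {p : Γ.Point} (hp : p ∈ P) :
    nu P p = ((segmentsBefore P p).ncard : ℤ) - 1 := by
  classical
  simp only [nu, Finsupp.coe_finsetSum, Finset.sum_apply, Finsupp.single_apply]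
  simp [hp]

lemma nu_apply_of_notMem (P : List Γ.Point) {p : Γ.Point} (hp : p ∉ P) : nu P p = 0 := by
  classical
  simp only [nu, Finsupp.coe_finsetSum, Finset.sum_apply, Finsupp.single_apply]
  simp [hp]

lemma finite_param (P : List Γ.Point) (e : E) :
    {t | t ∈ Icc 0 (Γ.len e) ∧ Γ.pt e t ∈ P}.Finite := by
  have h : {t | t ∈ Ioo 0 (Γ.len e) ∧ Γ.pt e t ∈ P}.Finite := by
    refine Set.Finite.of_finite_image (f := Γ.pt e)
      (P.finite_toSet.subset ?_) fun s hs t ht hst => ?_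
    · rintro _ ⟨t, ht, rfl⟩; exact ht.2
    · rw [Γ.pt_of_mem ht.1, pt_eq_inner_iff] at hst
      exact hst.2
  refine (h.union (Set.toFinite {0, Γ.len e})).subset ?_
  rintro t ⟨ht, htP⟩
  rcases ht.1.eq_or_lt with h1 | h1
  · right; left; exact h1.symm
  · rcases ht.2.eq_or_lt with h2 | h2
    · right; right; exact h2
    · left; exact ⟨⟨h1, h2⟩, htP⟩

lemma finite_segments [Finite E] (P : List Γ.Point) : {L | IsPSegment P L}.Finite := by
  refine (Set.finite_iUnion fun e : E => ((finite_param P e).prod (finite_param P e)).image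
    fun x : ℝ × ℝ => (e, x)).subset ?_
  rintro ⟨e, a, b⟩ ⟨h1, h2, h3, h4, h5, -⟩
  simp only at h1 h2 h3 h4 h5
  exact mem_iUnion.2 ⟨e, (a, b), ⟨⟨⟨h1, h2.le.trans h3⟩, h4⟩, ⟨⟨h1.trans h2.le, h3⟩, h5⟩⟩, rfl⟩

lemma finite_segmentsBefore [Finite E] (P : List Γ.Point) (p : Γ.Point) :
    (segmentsBefore P p).Finite :=
  (finite_segments P).subset fun _ h => h.1

lemma exists_segment_right {P : List Γ.Point} (hP : ∀ v, Point.vertex v ∈ P) {e : E} {a : ℝ}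
    (ha : a ∈ Ico 0 (Γ.len e)) (haP : Γ.pt e a ∈ P) : ∃ b, IsPSegment P (e, a, b) := by
  have hfin : {t | t ∈ Ioc a (Γ.len e) ∧ Γ.pt e t ∈ P}.Finite :=
    (finite_param P e).subset fun t ht => ⟨⟨ha.1.trans ht.1.1.le, ht.1.2⟩, ht.2⟩
  obtain ⟨b, hb, hmin⟩ := Set.exists_min_image _ id hfin
    ⟨Γ.len e, ⟨ha.2, le_rfl⟩, by rw [pt_len]; exact hP _⟩
  refine ⟨b, ha.1, hb.1.1, hb.1.2, haP, hb.2, fun t ht htP => ?_⟩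
  exact (hmin t ⟨⟨ht.1, ht.2.le.trans hb.1.2⟩, htP⟩).not_gt ht.2

lemma exists_segment_left {P : List Γ.Point} (hP : ∀ v, Point.vertex v ∈ P) {e : E} {b : ℝ}
    (hb : b ∈ Ioc 0 (Γ.len e)) (hbP : Γ.pt e b ∈ P) : ∃ a, IsPSegment P (e, a, b) := by
  have hfin : {t | t ∈ Ico 0 b ∧ Γ.pt e t ∈ P}.Finite :=
    (finite_param P e).subset fun t ht => ⟨⟨ht.1.1, ht.1.2.le.trans hb.2⟩, ht.2⟩
  obtain ⟨a, ha, hmax⟩ := Set.exists_max_image _ id hfin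
    ⟨0, ⟨le_rfl, hb.1⟩, by rw [pt_zero]; exact hP _⟩
  refine ⟨a, ha.1.1, ha.1.2, hb.2, ha.2, hbP, fun t ht htP => ?_⟩
  exact (hmax t ⟨⟨ha.1.1.trans ht.1.le, ht.2⟩, htP⟩).not_gt ht.1

lemma IsPSegment.right_unique {P : List Γ.Point} {e : E} {a b b' : ℝ}
    (h : IsPSegment P (e, a, b)) (h' : IsPSegment P (e, a, b')) : b = b' := by
  obtain ⟨-, h1, -, -, h2, h3⟩ := h
  obtain ⟨-, h1', -, -, h2', h3'⟩ := h'
  rcases lt_trichotomy b b' with h | h | h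
  · exact absurd h2 (h3' b ⟨h1, h⟩)
  · exact h
  · exact absurd h2' (h3 b' ⟨h1', h⟩)

lemma IsPSegment.left_unique {P : List Γ.Point} {e : E} {a a' b : ℝ}
    (h : IsPSegment P (e, a, b)) (h' : IsPSegment P (e, a', b)) : a = a' := by
  obtain ⟨-, h1, -, h2, -, h3⟩ := h
  obtain ⟨-, h1', -, h2', -, h3'⟩ := h'
  rcases lt_trichotomy a a' with h | h | h
  · exact absurd h2' (h3 a' ⟨h, h1'⟩)
  · exact h
  · exact absurd h2 (h3' a ⟨h, h1⟩)

end Segments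

section Directions

variable {V E : Type*} {Γ : MetricGraph V E}

/-- The vertex at which the dart `h` starts: the source of the edge for `(e, false)`, its target
for `(e, true)`. -/
def near (Γ : MetricGraph V E) (h : E × Bool) : V := if h.2 then Γ.tgt h.1 else Γ.src h.1

/-- The vertex at which a dart ends. -/
def far (Γ : MetricGraph V E) (h : E × Bool) : V := if h.2 then Γ.src h.1 else Γ.tgt h.1

/-- The direction `h` emanates from the point `p`, which has the parameter `t` on the edge. -/
def Emanates (p : Γ.Point) (h : E × Bool) (t : ℝ) : Prop :=
  Γ.pt h.1 t = p ∧ if h.2 then t ∈ Ioc 0 (Γ.len h.1) else t ∈ Ico 0 (Γ.len h.1)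

/-- The slope of `f` at the parameter `t` in the direction `h`. -/
noncomputable def dirSlope (Γ : MetricGraph V E) (f : Γ.Point → ℝ) (h : E × Bool) (t : ℝ) : ℝ :=
  if h.2 then Γ.slopeBackward f h.1 t else Γ.slopeForward f h.1 t

/-- Puts vertices and interior points on the same footing: the order is a sum over darts. A loop has
two darts at its vertex, and both darts of an edge emanate from each of its interior points. -/
lemma exists_directions [Fintype E] (p : Γ.Point) :
    ∃ (S : Finset (E × Bool)) (par : E × Bool → ℝ), (∀ h ∈ S, Emanates p h (par h)) ∧
      (∀ h t, Emanates p h t → h ∈ S ∧ t = par h) ∧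
      ∀ f, Γ.ord f p = ∑ h ∈ S, Γ.dirSlope f h (par h) := by
  classical
  cases p with
  | vertex v =>
    refine ⟨Finset.univ.filter fun h => Γ.near h = v, fun h => if h.2 then Γ.len h.1 else 0,
      ?_, ?_, ?_⟩
    · rintro ⟨e, b⟩ hb
      have := Γ.len_pos e
      replace hb := (Finset.mem_filter.1 hb).2
      cases b <;> simp [near, Emanates] at hb ⊢ <;> simp [pt_zero, pt_len, hb, this]
    · rintro ⟨e, b⟩ t ⟨h1, h2⟩
      have := Γ.len_pos e
      rw [pt_eq_vertex_iff] at h1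
      cases b
      · simp only [Bool.false_eq_true, if_false] at h2
        rcases h1 with ⟨h3, h4⟩ | ⟨h3, h4⟩
        · exact ⟨Finset.mem_filter.2 ⟨Finset.mem_univ _, h4⟩, le_antisymm h3 h2.1⟩
        · exact absurd h2.2 h3.not_gt
      · simp only [if_true] at h2
        rcases h1 with ⟨h3, h4⟩ | ⟨h3, h4⟩
        · exact absurd h2.1 h3.not_gt
        · exact ⟨Finset.mem_filter.2 ⟨Finset.mem_univ _, h4⟩, le_antisymm h2.2 h3⟩
    · intro f
      rw [Finset.sum_filter, Fintype.sum_prod_type, ord]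
      refine Finset.sum_congr rfl fun e _ => ?_
      simp [near, dirSlope, add_comm]
  | inner e t =>
    refine ⟨{(e, false), (e, true)}, fun _ => t, ?_, ?_, ?_⟩
    · intro h hh
      simp only [Finset.mem_insert, Finset.mem_singleton] at hh
      rcases hh with rfl | rfl
      · exact ⟨(inner_eq_pt Γ e t).symm, by simpa using ⟨t.2.1.le, t.2.2⟩⟩
      · exact ⟨(inner_eq_pt Γ e t).symm, by simpa using ⟨t.2.1, t.2.2.le⟩⟩
    · rintro ⟨e', b⟩ s ⟨h1, h2⟩
      obtain ⟨rfl, rfl⟩ := pt_eq_inner_iff Γ |>.1 h1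
      cases b <;> simp
    · intro f
      rw [Finset.sum_pair (by simp)]
      simp [dirSlope, ord]

end Directions

/-! ### Divisors below `ν_P` have an empty linear system -/

section Nonspecial

variable {V E : Type*} [Fintype E] {Γ : MetricGraph V E}

/-- A rational function whose divisor is nonnegative off `P` is convex on every `P`-segment. -/
lemma segment_slopes {f : Γ.Point → ℝ} (hf : Γ.IsRational f) {Δ : Γ.Divisor}
    (hΔ : ∀ p, (Δ p : ℝ) = Γ.ord f p) {P : List Γ.Point} (hP : ∀ p ∉ P, 0 ≤ Δ p)
    {e : E} {a b : ℝ} (hL : IsPSegment P (e, a, b)) :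
    (∃ k : ℤ, Γ.dirSlope f (e, false) a = k ∧ k * (b - a) ≤ f (Γ.pt e b) - f (Γ.pt e a)) ∧
    (∃ k : ℤ, Γ.dirSlope f (e, true) b = k ∧ k * (b - a) ≤ f (Γ.pt e a) - f (Γ.pt e b)) := by
  obtain ⟨m, hm⟩ := exists_hinge_restr hf hΔ e
  obtain ⟨ha, hab, hb, -, -, hint⟩ := hL
  simp only at ha hab hb hint
  have hK : ∀ s ∈ Ioo a b, 0 ≤ restr e Δ s := by
    intro s hs
    have hs' : s ∈ Ioo 0 (Γ.len e) := ⟨ha.trans_lt hs.1, hs.2.trans_le hb⟩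
    have h1 := restr_apply e Δ ⟨s, hs'⟩
    simp only at h1
    rw [h1]
    exact hP _ (by rw [← Γ.pt_of_mem hs']; exact hint s hs)
  have ea := hm a ⟨ha, hab.le.trans hb⟩
  have eb := hm b ⟨ha.trans hab.le, hb⟩
  have h1 := hinge_le_right hab.le hK
  have h2 := hinge_le_left hab.le hK
  refine ⟨⟨m + slopeRight a (restr e Δ), ?_, ?_⟩, ⟨-(m + slopeLeft b (restr e Δ)), ?_, ?_⟩⟩
  · simp only [dirSlope, Bool.false_eq_true, if_false]
    rw [slopeForward_eq hm ⟨ha, hab.trans_le hb⟩]; push_cast; ring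
  · rw [ea, eb]; push_cast; linarith
  · simp only [dirSlope, if_true]
    rw [slopeBackward_eq hm ⟨ha.trans_lt hab, hb⟩]; push_cast; ring
  · rw [ea, eb]; push_cast; linarith

/-- A divisor bounded by the divisor of a permutation is not equivalent to an effective one. -/
theorem linearSystem_eq_empty_of_le_nu [Nonempty V] {P : List Γ.Point}
    (hP : ∀ v, Point.vertex v ∈ P) {A : Γ.Divisor} (hA : A ≤ nu P) : linearSystem A = ∅ := by
  classical
  rw [Set.eq_empty_iff_forall_notMem]
  rintro F ⟨hF, f, hf, hFA⟩
  set Δ := F - A with hΔdef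
  have hΔ : ∀ p, (Δ p : ℝ) = Γ.ord f p := fun p => by
    rw [hΔdef, Finsupp.sub_apply, Int.cast_sub, hFA p]; ring
  have hge : ∀ p, 0 ≤ nu P p + Δ p := fun p => by
    have h1 := hF p
    have h2 := hA p
    rw [hΔdef, Finsupp.sub_apply]
    simp only [Finsupp.coe_zero, Pi.zero_apply] at h1
    omega
  have hoff : ∀ p ∉ P, 0 ≤ Δ p := fun p hp => by
    have := hge p; rwa [nu_apply_of_notMem P hp, zero_add] at this
  -- The first point of `P` at which the maximum of `f` over `P` is attained; points before it have
  -- strictly smaller values.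
  obtain ⟨p, hpP, hmax, hfirst⟩ : ∃ p ∈ P, (∀ q ∈ P, f q ≤ f p) ∧
      ∀ q, Precedes P q p → f q < f p := by
    obtain ⟨v⟩ := ‹Nonempty V›
    obtain ⟨p0, hp0, hmax⟩ := Finset.exists_max_image P.toFinset f
      ⟨_, List.mem_toFinset.2 (hP v)⟩
    obtain ⟨p, hp, hmin⟩ := Finset.exists_min_image (P.toFinset.filter fun p => f p = f p0)
      (fun p => P.idxOf p) ⟨p0, Finset.mem_filter.2 ⟨hp0, rfl⟩⟩
    rw [Finset.mem_filter, List.mem_toFinset] at hp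
    refine ⟨p, hp.1, fun q hq => hp.2 ▸ hmax q (List.mem_toFinset.2 hq), fun q hq => ?_⟩
    refine lt_of_le_of_ne (hp.2 ▸ hmax q (List.mem_toFinset.2 hq.1)) fun heq => ?_
    have h1 := hmin q (Finset.mem_filter.2 ⟨List.mem_toFinset.2 hq.1, heq.trans hp.2⟩)
    have h2 := hq.2.2
    have h3 : List.idxOf q P = @List.idxOf _ instBEqOfDecidableEq q P := by congr!
    have h4 : List.idxOf p P = @List.idxOf _ instBEqOfDecidableEq p P := by congr!
    omega
  obtain ⟨S, par, hS, hS', hord⟩ := exists_directions p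
  -- By convexity, slope times length is at most the increase of `f` along the segment, which is not
  -- positive at a maximum.
  have key : ∀ h ∈ S, ∃ k : ℤ, Γ.dirSlope f h (par h) = k ∧ k ≤ 0 := by
    rintro ⟨e, b⟩ hh
    have hem := hS _ hh
    obtain ⟨hpt, hpar⟩ := hem
    cases b
    · simp only [Bool.false_eq_true, if_false] at hpar hpt
      obtain ⟨b, hL⟩ := exists_segment_right hP hpar (by rw [hpt]; exact hpP)
      obtain ⟨⟨k, hk, hk'⟩, -⟩ := segment_slopes hf hΔ hoff hL
      refine ⟨k, hk, ?_⟩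
      have h1 := hmax _ hL.2.2.2.2.1
      have h2 := hL.2.1
      simp only at h1 h2
      rw [hpt] at hk'
      by_contra hc
      have : (1 : ℝ) ≤ k := by exact_mod_cast (by omega : 1 ≤ k)
      nlinarith
    · simp only [if_true] at hpar hpt
      obtain ⟨a, hL⟩ := exists_segment_left hP hpar (by rw [hpt]; exact hpP)
      obtain ⟨-, ⟨k, hk, hk'⟩⟩ := segment_slopes hf hΔ hoff hL
      refine ⟨k, hk, ?_⟩
      have h1 := hmax _ hL.2.2.2.1
      have h2 := hL.2.1
      simp only at h1 h2
      rw [hpt] at hk'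
      by_contra hc
      have : (1 : ℝ) ≤ k := by exact_mod_cast (by omega : 1 ≤ k)
      nlinarith
  choose! k hk hk0 using key
  -- The other end of the segment precedes `p`, hence differs from `p`, so the direction is
  -- determined. Along it `f` drops strictly, and integrality makes the slope at most `-1`.
  let g : E × ℝ × ℝ → E × Bool := fun L =>
    if Γ.pt L.1 L.2.1 = p then (L.1, false) else (L.1, true)
  have irrefl : ∀ q, Precedes P q p → q ≠ p := fun q hq h => by
    subst h; exact absurd hq.2.2 (lt_irrefl _)
  have hg : ∀ L ∈ segmentsBefore P p, g L ∈ S ∧ k (g L) ≤ -1 ∧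
      ((g L = (L.1, false) ∧ L.2.1 = par (g L)) ∨ (g L = (L.1, true) ∧ L.2.2 = par (g L))) := by
    rintro ⟨e, a, b⟩ ⟨hL, hor⟩
    obtain ⟨⟨k1, hk1, hk1'⟩, ⟨k2, hk2, hk2'⟩⟩ := segment_slopes hf hΔ hoff hL
    have hab := hL.2.1
    simp only at hor hab
    rcases hor with ⟨h1, h2⟩ | ⟨h1, h2⟩
    · have hgL : g (e, a, b) = (e, false) := if_pos h1
      obtain ⟨h3, h4⟩ := hS' (e, false) a
        ⟨h1, by simpa using ⟨hL.1, hL.2.1.trans_le hL.2.2.1⟩⟩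
      rw [hgL]
      refine ⟨h3, ?_, Or.inl ⟨rfl, h4⟩⟩
      have h5 := hk _ h3
      rw [← h4, hk1] at h5
      have h6 : k1 = k (e, false) := by exact_mod_cast h5
      rw [← h6]
      have h7 := hfirst _ h2
      rw [h1] at hk1'
      by_contra hc
      have : (0 : ℝ) ≤ k1 := by exact_mod_cast (by omega : 0 ≤ k1)
      nlinarith
    · have hgL : g (e, a, b) = (e, true) := if_neg (irrefl _ h2)
      obtain ⟨h3, h4⟩ := hS' (e, true) b
        ⟨h1, by simpa using ⟨hL.1.trans_lt hL.2.1, hL.2.2.1⟩⟩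
      rw [hgL]
      refine ⟨h3, ?_, Or.inr ⟨rfl, h4⟩⟩
      have h5 := hk _ h3
      rw [← h4, hk2] at h5
      have h6 : k2 = k (e, true) := by exact_mod_cast h5
      rw [← h6]
      have h7 := hfirst _ h2
      rw [h1] at hk2'
      by_contra hc
      have : (0 : ℝ) ≤ k2 := by exact_mod_cast (by omega : 0 ≤ k2)
      nlinarith
  have hinj : Set.InjOn g (segmentsBefore P p) := by
    rintro ⟨e, a, b⟩ hL ⟨e', a', b'⟩ hL' heq
    obtain ⟨-, -, h1⟩ := hg _ hL
    obtain ⟨-, -, h2⟩ := hg _ hL'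
    rw [heq] at h1
    rcases h1 with ⟨h1, h3⟩ | ⟨h1, h3⟩ <;> rcases h2 with ⟨h2, h4⟩ | ⟨h2, h4⟩ <;>
      rw [h1] at h2 <;> simp at h2 <;> subst h2
    · have : a = a' := h3.trans h4.symm
      subst this
      rw [hL.1.right_unique hL'.1]
    · have : b = b' := h3.trans h4.symm
      subst this
      rw [hL.1.left_unique hL'.1]
  have hcard : (segmentsBefore P p).ncard ≤ (S.filter fun h => k h ≤ -1).card := by
    rw [← Set.ncard_coe_finset]
    refine Set.ncard_le_ncard_of_injOn g (fun L hL => ?_) hinj (Finset.finite_toSet _)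
    exact Finset.mem_coe.2 (Finset.mem_filter.2 ⟨(hg L hL).1, (hg L hL).2.1⟩)
  have hsum : ∑ h ∈ S, k h ≤ -((S.filter fun h => k h ≤ -1).card : ℤ) := by
    rw [Finset.card_filter, Nat.cast_sum, ← Finset.sum_neg_distrib]
    refine Finset.sum_le_sum fun h hh => ?_
    have := hk0 h hh
    split_ifs <;> simp <;> omega
  -- Thus `Δ p ≤ -|S_P(p)|`, whereas `F ≥ 0` and `A ≤ ν_P` require `Δ p ≥ 1 - |S_P(p)|`.
  have hΔp : Δ p = ∑ h ∈ S, k h := by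
    have : (Δ p : ℝ) = ((∑ h ∈ S, k h : ℤ) : ℝ) := by
      rw [hΔ, hord, Int.cast_sum]
      exact Finset.sum_congr rfl hk
    exact_mod_cast this
  have := hge p
  rw [nu_apply P hpP] at this
  omega

end Nonspecial

end MetricGraph

namespace MetricGraph

/-! ### From a burning order to a permutation -/

section Sorting

variable {V E : Type*} {Γ : MetricGraph V E}

lemma exists_sorted_list (S : Finset Γ.Point) (g : Γ.Point → ℕ) :
    ∃ P : List Γ.Point, P.Nodup ∧ (∀ p, p ∈ P ↔ p ∈ S) ∧
      ∀ p ∈ S, ∀ q ∈ S, g p < g q → Precedes P p q := by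
  classical
  let P := S.toList.mergeSort fun a b => decide (g a ≤ g b)
  have hperm : P.Perm S.toList := List.mergeSort_perm _ _
  have hmem : ∀ p, p ∈ P ↔ p ∈ S := fun p => by rw [hperm.mem_iff, Finset.mem_toList]
  have hsort : P.Pairwise fun a b => g a ≤ g b := by
    have := List.pairwise_mergeSort (le := fun a b => decide (g a ≤ g b))
      (fun a b c h1 h2 => by simp at *; omega) (fun a b => by simp; omega) S.toList
    exact this.imp fun h => by simpa using h
  refine ⟨P, hperm.nodup_iff.2 S.nodup_toList, hmem, fun p hp q hq hlt => ?_⟩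
  refine ⟨(hmem p).2 hp, (hmem q).2 hq, ?_⟩
  have hp' := (hmem p).2 hp
  have hq' := (hmem q).2 hq
  by_contra hc
  rw [not_lt] at hc
  have h1 := List.idxOf_lt_length_of_mem hp'
  have h2 := List.idxOf_lt_length_of_mem hq'
  have e1 := List.getElem_idxOf h1
  have e2 := List.getElem_idxOf h2
  rcases hc.eq_or_lt with h | h
  · have : p = q := by rw [← e1, ← e2]; congr 1; exact h.symm
    subst this; exact lt_irrefl _ hlt
  · have := List.pairwise_iff_getElem.1 hsort _ _ h2 h1 h
    rw [e1, e2] at this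
    omega

end Sorting

section Configurations

variable {V E : Type*} {Γ : MetricGraph V E}

open Classical in
/-- The point with parameter `t` of the edge `e` if it is an interior point, and `0` otherwise. -/
noncomputable def chip (Γ : MetricGraph V E) (e : E) (t : ℝ) : Γ.Divisor :=
  if t ∈ Ioo 0 (Γ.len e) then Finsupp.single (Γ.pt e t) 1 else 0

lemma chip_of_mem {e : E} {t : ℝ} (h : t ∈ Ioo 0 (Γ.len e)) :
    Γ.chip e t = Finsupp.single (Γ.pt e t) 1 := by rw [chip, if_pos h]

lemma chip_of_notMem {e : E} {t : ℝ} (h : t ∉ Ioo 0 (Γ.len e)) : Γ.chip e t = 0 := by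
  rw [chip, if_neg h]

@[simp] lemma chip_zero (e : E) : Γ.chip e 0 = 0 := chip_of_notMem fun h => lt_irrefl _ h.1

lemma chip_nonneg (e : E) (t : ℝ) : 0 ≤ Γ.chip e t := by
  unfold chip
  split_ifs
  · exact Finsupp.single_nonneg.2 zero_le_one
  · exact le_rfl

@[simp] lemma chip_vertex (e : E) (t : ℝ) (v : V) : Γ.chip e t (.vertex v) = 0 := by
  classical
  by_cases h : t ∈ Ioo 0 (Γ.len e)
  · rw [chip_of_mem h, Γ.pt_of_mem h, Finsupp.single_apply, if_neg (by simp)]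
  · rw [chip_of_notMem h]; rfl

open Classical in
lemma chip_inner (e e' : E) (s : ℝ) (t : Ioo (0 : ℝ) (Γ.len e')) :
    Γ.chip e s (.inner e' t) = if e = e' ∧ s = t then 1 else 0 := by
  by_cases h : s ∈ Ioo 0 (Γ.len e)
  · rw [chip_of_mem h, Finsupp.single_apply]
    exact if_congr (pt_eq_inner_iff Γ) rfl rfl
  · rw [chip_of_notMem h, if_neg]; · rfl
    rintro ⟨rfl, rfl⟩; exact h t.2

lemma sum_chip_vertex (Z : Finset E) (τ : E → ℝ) (v : V) :
    (∑ e ∈ Z, Γ.chip e (τ e)) (.vertex v) = 0 := by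
  simp [Finsupp.coe_finsetSum]

open Classical in
lemma sum_chip_inner (Z : Finset E) (τ : E → ℝ) (e : E) (t : Ioo (0 : ℝ) (Γ.len e)) :
    (∑ e ∈ Z, Γ.chip e (τ e)) (.inner e t) = if e ∈ Z ∧ τ e = t then 1 else 0 := by
  rw [Finsupp.coe_finsetSum, Finset.sum_apply]
  simp only [chip_inner]
  by_cases h : e ∈ Z
  · rw [Finset.sum_eq_single_of_mem e h fun b _ hb => if_neg fun h => hb h.1]
    simp [h]
  · rw [Finset.sum_eq_zero fun b hb => if_neg fun hbe : b = e ∧ τ b = t => h (hbe.1 ▸ hb),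
      if_neg fun h' => h h'.1]

lemma IsLoopTransversal.exists_param {I : Set Γ.Point} (hI : Γ.IsLoopTransversal I) :
    ∃ σ : E → ℝ, (∀ e, Γ.src e = Γ.tgt e → σ e ∈ Ioo 0 (Γ.len e)) ∧
      ∀ p ∈ I, ∃ e, Γ.src e = Γ.tgt e ∧ p = Γ.pt e (σ e) := by
  have h : ∀ e, ∃ s : ℝ, Γ.src e = Γ.tgt e → s ∈ Ioo 0 (Γ.len e) ∧
      ∀ p ∈ I, p ∈ Γ.interior e → p = Γ.pt e s := by
    intro e
    by_cases he : Γ.src e = Γ.tgt e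
    · obtain ⟨p, ⟨-, t, rfl⟩, huniq⟩ := hI.2 e he
      exact ⟨t, fun _ => ⟨t.2, fun q hq hqe => by rw [huniq q ⟨hq, hqe⟩, inner_eq_pt]⟩⟩
    · exact ⟨0, fun h => absurd h he⟩
  choose σ hσ using h
  refine ⟨σ, fun e he => (hσ e he).1, fun p hp => ?_⟩
  obtain ⟨e, he, hpe⟩ := hI.1 p hp
  exact ⟨e, he, (hσ e he).2 p hp hpe⟩

variable [Fintype V] [Fintype E]

/-- The divisor with coefficients `n` at the vertices and a chip at the point with parameter `τ e`
of every edge `e` for which this is an interior point. -/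
noncomputable def config (Γ : MetricGraph V E) (n : V → ℤ) (τ : E → ℝ) : Γ.Divisor :=
  ∑ v, Finsupp.single (.vertex v) (n v) + ∑ e, Γ.chip e (τ e)

@[simp] lemma config_vertex (n : V → ℤ) (τ : E → ℝ) (v : V) :
    Γ.config n τ (.vertex v) = n v := by
  classical
  rw [config, Finsupp.add_apply, sum_chip_vertex, Finsupp.coe_finsetSum, Finset.sum_apply]
  simp [Finsupp.single_apply]

open Classical in
lemma config_inner (n : V → ℤ) (τ : E → ℝ) (e : E) (t : Ioo (0 : ℝ) (Γ.len e)) :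
    Γ.config n τ (.inner e t) = if τ e = t then 1 else 0 := by
  rw [config, Finsupp.add_apply, sum_chip_inner, Finsupp.coe_finsetSum, Finset.sum_apply]
  simp

/-- `ρ` records the times at which the vertices burn when the configuration of chips is burnt
according to Dhar's algorithm, the loops in `Z` having been burnt at the beginning. -/
def Burns (Γ : MetricGraph V E) (n : V → ℤ) (τ : E → ℝ) (ρ : V → ℕ) (Z : Set E) : Prop :=
  ∀ v, n v + 1 ≤ {h : E × Bool | Γ.near h = v ∧
    ((ρ (Γ.far h) < ρ v ∧ τ h.1 ∉ Ioo 0 (Γ.len h.1)) ∨ h.1 ∈ Z)}.ncard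

/-- The order is: transversal points of the loops in `Z`, vertices as they burn, other transversal
points, chips. Burning darts at a vertex give segments to preceding points. A chip follows both of
its neighbours, so `ν_P ≥ 1` there; another transversal point follows at least one neighbour, so
`ν_P ≥ 0`; on `Z` the trivial bound `ν_P ≥ -1` suffices, as a chip is subtracted. -/
theorem Burns.exists_permutation {I : Set Γ.Point} {σ : E → ℝ}
    (hσ : ∀ e, Γ.src e = Γ.tgt e → σ e ∈ Ioo 0 (Γ.len e))
    (hI : ∀ p ∈ I, ∃ e, Γ.src e = Γ.tgt e ∧ p = Γ.pt e (σ e))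
    {n : V → ℤ} {τ : E → ℝ} {ρ : V → ℕ} {Z : Finset E} (h : Γ.Burns n τ ρ Z)
    (hZ : ∀ e ∈ Z, Γ.src e = Γ.tgt e ∧ τ e ∉ Ioo 0 (Γ.len e)) :
    ∃ P, Γ.IsPermutation I P ∧ Γ.config n τ - ∑ e ∈ Z, Γ.chip e (σ e) ≤ nu P := by
  classical
  let S : Finset Γ.Point := (Finset.univ.image Point.vertex) ∪
    ((Finset.univ.filter fun e => τ e ∈ Ioo 0 (Γ.len e)).image fun e => Γ.pt e (τ e)) ∪
    ((Finset.univ.filter fun e => Γ.src e = Γ.tgt e).image fun e => Γ.pt e (σ e))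
  obtain ⟨N, hN⟩ : ∃ N, ∀ v, ρ v ≤ N :=
    ⟨Finset.univ.sup ρ, fun v => Finset.le_sup (f := ρ) (Finset.mem_univ v)⟩
  -- Vertices occupy the values from `1` to `N + 1`. Off `Z`, a transversal point that carries a
  -- chip is ranked as a chip.
  let g : Γ.Point → ℕ := fun p => match p with
    | .vertex v => ρ v + 1
    | .inner e t => if e ∈ Z then 0 else if (t : ℝ) = τ e then N + 3 else N + 2
  obtain ⟨P, hnd, hPS, hprec⟩ := exists_sorted_list S g
  have hPv : ∀ v, Point.vertex v ∈ P := fun v => (hPS _).2 (by simp [S])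
  have hPσ : ∀ e, Γ.src e = Γ.tgt e → Γ.pt e (σ e) ∈ P := fun e he => (hPS _).2 <| by
    simp only [S, Finset.mem_union, Finset.mem_image, Finset.mem_filter, Finset.mem_univ, true_and]
    exact Or.inr ⟨e, he, rfl⟩
  have hPτ : ∀ e, τ e ∈ Ioo 0 (Γ.len e) → Γ.pt e (τ e) ∈ P := fun e he => (hPS _).2 <| by
    simp only [S, Finset.mem_union, Finset.mem_image, Finset.mem_filter, Finset.mem_univ, true_and]
    exact Or.inl (Or.inr ⟨e, he, rfl⟩)
  have hPi : ∀ e (t : Ioo (0 : ℝ) (Γ.len e)), .inner e t ∈ P →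
      (t : ℝ) = τ e ∨ (Γ.src e = Γ.tgt e ∧ (t : ℝ) = σ e) := by
    intro e t ht
    rw [hPS] at ht
    simp only [S, Finset.mem_union, Finset.mem_image, Finset.mem_filter, Finset.mem_univ,
      true_and, reduceCtorEq, exists_false, false_or] at ht
    rcases ht with ⟨e', -, h2⟩ | ⟨e', h1, h2⟩
    · obtain ⟨rfl, h3⟩ := (pt_eq_inner_iff Γ).1 h2
      exact Or.inl h3.symm
    · obtain ⟨rfl, h3⟩ := (pt_eq_inner_iff Γ).1 h2
      exact Or.inr ⟨h1, h3.symm⟩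
  have hprec' : ∀ p ∈ P, ∀ q ∈ P, g p < g q → Precedes P p q := fun p hp q hq =>
    hprec p ((hPS p).1 hp) q ((hPS q).1 hq)
  have hnone : ∀ e t, τ e ∉ Ioo 0 (Γ.len e) → t ∈ Ioo 0 (Γ.len e) →
      (Γ.src e = Γ.tgt e → t ≠ σ e) → Γ.pt e t ∉ P := by
    intro e t hτ ht hs hP
    rw [Γ.pt_of_mem ht] at hP
    rcases hPi e _ hP with h1 | ⟨h1, h2⟩
    · exact hτ (h1 ▸ ht)
    · exact hs h1 h2
  refine ⟨P, ⟨hnd, hPv, fun p hp => ?_⟩, fun p => ?_⟩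
  · obtain ⟨e, he, rfl⟩ := hI p hp
    exact hPσ e he
  rw [Finsupp.sub_apply]
  cases p with
  | vertex v =>
    rw [config_vertex, sum_chip_vertex, sub_zero, nu_apply P (hPv v)]
    have hv := h v
    suffices {h : E × Bool | Γ.near h = v ∧ ((ρ (Γ.far h) < ρ v ∧ τ h.1 ∉ Ioo 0 (Γ.len h.1)) ∨
        h.1 ∈ (Z : Set E))}.ncard ≤ (segmentsBefore P (Point.vertex v)).ncard by omega
    -- A loop of `Z` is cut by its transversal point into two segments, one for each dart. Any other
    -- burning dart belongs to an edge that is not a loop and has no point of `P` inside, so the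
    -- whole edge is the segment.
    let G : E × Bool → E × ℝ × ℝ := fun h =>
      if h.1 ∈ Z then (if h.2 then (h.1, σ h.1, Γ.len h.1) else (h.1, 0, σ h.1))
      else (h.1, 0, Γ.len h.1)
    refine Set.ncard_le_ncard_of_injOn G ?_ ?_ (finite_segmentsBefore P _)
    · rintro ⟨e, b⟩ ⟨hnear, hcase⟩
      have hl := Γ.len_pos e
      by_cases he : e ∈ Z
      · obtain ⟨hloop, hτ⟩ := hZ e he
        have hs := hσ e hloop
        have hpre : Precedes P (Γ.pt e (σ e)) (.vertex v) := by
          refine hprec' _ (hPσ e hloop) _ (hPv v) ?_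
          rw [Γ.pt_of_mem hs]; simp [g, he]
        cases b
        · simp only [near, Bool.false_eq_true, if_false] at hnear
          simp only [G, he, if_true, Bool.false_eq_true, if_false]
          refine ⟨⟨le_rfl, hs.1, hs.2.le, ?_, hPσ e hloop, fun t ht => ?_⟩, Or.inl ⟨?_, hpre⟩⟩
          · simp only [pt_zero]; exact hPv _
          · exact hnone e t hτ ⟨ht.1, ht.2.trans hs.2⟩ fun _ => ht.2.ne
          · simp only [pt_zero, hnear]
        · simp only [near, if_true] at hnear
          simp only [G, he, if_true]
          refine ⟨⟨hs.1.le, hs.2, le_rfl, hPσ e hloop, ?_, fun t ht => ?_⟩, Or.inr ⟨?_, hpre⟩⟩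
          · simp only [pt_len]; exact hPv _
          · exact hnone e t hτ ⟨hs.1.trans ht.1, ht.2⟩ fun _ => ht.1.ne'
          · simp only [pt_len, hnear]
      · have hcase' : ρ (Γ.far (e, b)) < ρ v ∧ τ e ∉ Ioo 0 (Γ.len e) :=
          hcase.resolve_right fun h => he (by simpa using h)
        have hpre : Precedes P (.vertex (Γ.far (e, b))) (.vertex v) :=
          hprec' _ (hPv _) _ (hPv v) (by simpa [g] using hcase'.1)
        have hnl : Γ.src e ≠ Γ.tgt e := by
          intro hh
          have h1 := hcase'.1
          rw [← hnear] at h1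
          cases b <;> simp [near, far, hh] at h1
        simp only [G, he, if_false]
        refine ⟨⟨le_rfl, hl, le_rfl, ?_, ?_, fun t ht => ?_⟩, ?_⟩
        · simp only [pt_zero]; exact hPv _
        · simp only [pt_len]; exact hPv _
        · exact hnone e t hcase'.2 ht fun h => absurd h hnl
        · simp only [pt_zero, pt_len]
          cases b
          · left; simp only [near, far, Bool.false_eq_true, if_false] at hnear hpre
            rw [hnear]; exact ⟨rfl, hpre⟩
          · right; simp only [near, far, if_true] at hnear hpre
            rw [hnear]; exact ⟨rfl, hpre⟩
    · rintro ⟨e, b⟩ ⟨hn, hc⟩ ⟨e', b'⟩ ⟨hn', hc'⟩ heq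
      have hee : e = e' := by
        have := congrArg Prod.fst heq
        simp only [G] at this
        split_ifs at this <;> exact this
      subst hee
      by_cases he : e ∈ Z
      · have hs := hσ e (hZ e he).1
        have h2 := congrArg (fun x => x.2.1) heq
        cases b <;> cases b' <;> simp [G, he] at h2 ⊢
        · exact hs.1.ne h2
        · exact hs.1.ne' h2
      -- The two darts of an edge share their image, but they cannot both start at `v` and end at
      -- vertices burnt earlier.
      · by_contra hne
        have hc1 : ρ (Γ.far (e, b)) < ρ v := (hc.resolve_right fun h => he (by simpa using h)).1
        have hfar : Γ.far (e, b) = Γ.near (e, b') := by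
          cases b <;> cases b' <;> simp [near, far] at hne ⊢
        rw [hfar, hn'] at hc1
        exact lt_irrefl _ hc1
  | inner e t =>
    rw [config_inner, sum_chip_inner]
    by_cases htP : Point.inner e t ∈ P
    · rw [nu_apply P htP]
      have hnn : (0 : ℤ) ≤ (segmentsBefore P (Point.inner e t)).ncard := Int.natCast_nonneg _
      by_cases heZ : e ∈ Z
      · obtain ⟨hloop, hτ⟩ := hZ e heZ
        have h1 : ¬ τ e = t := fun hh => hτ (hh ▸ t.2)
        have h2 : (t : ℝ) = σ e := ((hPi e t htP).resolve_left fun hh => h1 hh.symm).2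
        rw [if_neg h1, if_pos ⟨heZ, h2.symm⟩]
        omega
      · rw [if_neg (c := e ∈ Z ∧ σ e = t) fun h => heZ h.1, sub_zero]
        have htP' : Γ.pt e t ∈ P := by rw [← inner_eq_pt]; exact htP
        obtain ⟨a, ha⟩ := exists_segment_left hPv ⟨t.2.1, t.2.2.le⟩ htP'
        obtain ⟨b, hb⟩ := exists_segment_right hPv ⟨t.2.1.le, t.2.2⟩ htP'
        have ha1 := ha.1
        have ha2 := ha.2.1
        have hb1 := hb.2.1
        have hb2 := hb.2.2.1
        simp only at ha1 ha2 hb1 hb2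
        have hpre : ∀ x ∈ Icc 0 (Γ.len e), Γ.pt e x ∈ P → x ≠ t → (τ e = t ∨ x ≠ τ e) →
            Precedes P (Γ.pt e x) (.inner e t) := by
          intro x hx hxP hxt hor
          refine hprec' _ hxP _ htP ?_
          have hv : ∀ v, g (.vertex v) < g (.inner e t) := by
            intro v
            have := hN v
            simp only [g, heZ, if_false]
            split_ifs <;> omega
          rcases hx.1.eq_or_lt with h0 | h0
          · rw [← h0, pt_zero]; exact hv _
          rcases hx.2.eq_or_lt with h1 | h1
          · rw [h1, pt_len]; exact hv _
          have hxP' := hxP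
          rw [Γ.pt_of_mem ⟨h0, h1⟩] at hxP' ⊢
          rcases hor with hor | hor
          · have : x ≠ τ e := hor ▸ hxt
            simp [g, heZ, hor.symm, this]
          · obtain ⟨-, h3⟩ := (hPi e _ hxP').resolve_left hor
            have h4 : (t : ℝ) = τ e := (hPi e t htP).resolve_right fun h => hxt (h3.trans h.2.symm)
            simp [g, heZ, hor, h4]
        have haP : τ e = t ∨ a ≠ τ e → (e, a, (t : ℝ)) ∈ segmentsBefore P (Point.inner e t) :=
          fun hor => ⟨ha, Or.inr ⟨(inner_eq_pt Γ e t).symm,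
            hpre a ⟨ha1, by linarith⟩ ha.2.2.2.1 ha2.ne hor⟩⟩
        have hbP : τ e = t ∨ b ≠ τ e → (e, (t : ℝ), b) ∈ segmentsBefore P (Point.inner e t) :=
          fun hor => ⟨hb, Or.inl ⟨(inner_eq_pt Γ e t).symm,
            hpre b ⟨by linarith, hb2⟩ hb.2.2.2.2.1 hb1.ne' hor⟩⟩
        by_cases hτ : τ e = t
        · rw [if_pos hτ]
          have hne : (e, a, (t : ℝ)) ≠ (e, (t : ℝ), b) := fun hh =>
            ha2.ne (congrArg (fun x => x.2.1) hh)
          have := Set.ncard_le_ncard (s := {(e, a, (t : ℝ)), (e, (t : ℝ), b)})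
            (Set.insert_subset (haP (Or.inl hτ)) (Set.singleton_subset_iff.2 (hbP (Or.inl hτ))))
            (finite_segmentsBefore P _)
          rw [Set.ncard_pair hne] at this
          omega
        · rw [if_neg hτ]
          -- At most one of the two neighbours is the chip, and the other one precedes.
          have hpos : 0 < (segmentsBefore P (Point.inner e t)).ncard := by
            rw [Set.ncard_pos (finite_segmentsBefore P _)]
            by_cases haτ : a = τ e
            · exact ⟨_, hbP (Or.inr fun hbτ => by linarith)⟩
            · exact ⟨_, haP (Or.inr haτ)⟩
          omega
    · rw [nu_apply_of_notMem P htP]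
      have h1 : ¬ τ e = t := fun hh => htP <| by
        rw [inner_eq_pt, ← hh]; exact hPτ e (hh ▸ t.2)
      rw [if_neg h1]
      split_ifs <;> simp

end Configurations

end MetricGraph

namespace MetricGraph

/-! ### Divisors with at most one chip inside each edge -/

section NormalForm

variable {V E : Type*} [Fintype V] [Fintype E] {Γ : MetricGraph V E}

open Classical in
lemma restr_config (n : V → ℤ) (τ : E → ℝ) (e : E) :
    restr e (Γ.config n τ) =
      if τ e ∈ Ioo 0 (Γ.len e) then Finsupp.single (τ e) 1 else 0 := by
  ext s
  by_cases hs : s ∈ Ioo 0 (Γ.len e)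
  · have h1 := restr_apply e (Γ.config n τ) ⟨s, hs⟩
    simp only at h1
    rw [h1, config_inner]
    by_cases h : τ e = s
    · subst h; simp [hs]
    · rw [if_neg (show ¬ τ e = ((⟨s, hs⟩ : Ioo 0 (Γ.len e)) : ℝ) from h)]
      split_ifs <;> simp [h]
  · rw [restr_eq_zero e _ hs]
    split_ifs with h
    · have : τ e ≠ s := fun hh => hs (hh ▸ h)
      simp [this]
    · rfl

/-- The slope in the direction of `h` of the linear function on the edge that increases by `a`
from the source to the target. -/
noncomputable def dartSlope (Γ : MetricGraph V E) (a : E → ℝ) (h : E × Bool) : ℝ :=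
  (if h.2 then -a h.1 else a h.1) / Γ.len h.1

open Classical in
/-- The coefficients at the vertices of the divisor obtained from `n` if every edge `e` has slopes
the roundings of the slope of a function that increases by `a e`. -/
noncomputable def vertexCoeff (Γ : MetricGraph V E) (n : V → ℤ) (a : E → ℝ) (v : V) : ℤ :=
  n v + ∑ h, if Γ.near h = v then ⌊Γ.dartSlope a h⌋ else 0

/-- The place where the rounded slope changes. -/
noncomputable def chipParam (Γ : MetricGraph V E) (a : E → ℝ) (e : E) : ℝ :=
  Γ.len e * Int.fract (-a e / Γ.len e)

omit [Fintype V] [Fintype E] in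
lemma chipParam_mem (a : E → ℝ) (e : E) : Γ.chipParam a e ∈ Ico 0 (Γ.len e) := by
  have hl := Γ.len_pos e
  refine ⟨mul_nonneg hl.le (Int.fract_nonneg _), ?_⟩
  have := mul_lt_mul_of_pos_left (Int.fract_lt_one (-a e / Γ.len e)) hl
  simpa [chipParam] using this

omit [Fintype V] [Fintype E] in
lemma fract_pos_of_chipParam_mem {a : E → ℝ} {e : E}
    (h : Γ.chipParam a e ∈ Ioo 0 (Γ.len e)) : 0 < Int.fract (-a e / Γ.len e) :=
  (pos_iff_pos_of_mul_pos h.1).1 (Γ.len_pos e)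

omit [Fintype V] [Fintype E] in
lemma fract_eq_zero_of_chipParam_notMem {a : E → ℝ} {e : E}
    (h : Γ.chipParam a e ∉ Ioo 0 (Γ.len e)) : Int.fract (-a e / Γ.len e) = 0 := by
  by_contra hne
  have := (Int.fract_nonneg (-a e / Γ.len e)).lt_of_ne' hne
  exact h ⟨mul_pos (Γ.len_pos e) this, (chipParam_mem a e).2⟩

open Classical in
/-- The coefficients at the vertices after the interior of every edge has been moved to its
source. -/
noncomputable def baseCoeff (D : Γ.Divisor) (v : V) : ℤ :=
  D (.vertex v) + ∑ e, if Γ.src e = v then total (restr e D) else 0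

/-- The contribution of the interior of an edge to the shift of its slopes in that process. -/
noncomputable def baseShift (D : Γ.Divisor) (e : E) : ℝ :=
  hinge (Γ.len e) (restr e D) - total (restr e D) * Γ.len e

/-- The function that realizes the equivalence takes the values `φ` at the vertices. On each edge it
cancels the interior part of `D` and leaves an increase of `a e` to a convex piece with slopes `⌊a e
/ ℓ⌋` and `⌈a e / ℓ⌉`. These differ by at most one, so there is at most one kink, and it has
multiplicity one. -/
theorem linEquiv_config (D : Γ.Divisor) (φ : V → ℝ) (a : E → ℝ)
    (ha : ∀ e, a e = baseShift D e + (φ (Γ.tgt e) - φ (Γ.src e))) :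
    LinEquiv D (Γ.config (Γ.vertexCoeff (baseCoeff D) a) (Γ.chipParam a)) := by
  classical
  rw [linEquiv_iff]
  refine ⟨-φ, fun e => -(total (restr e D) + ⌊a e / Γ.len e⌋), fun e => ?_, fun v => ?_⟩
  · rw [map_sub, map_sub, restr_config]
    have hl := Γ.len_pos e
    have hae := ha e
    simp only [baseShift] at hae
    have key : (⌊a e / Γ.len e⌋ : ℝ) * Γ.len e + hinge (Γ.len e)
        (if Γ.chipParam a e ∈ Ioo 0 (Γ.len e) then Finsupp.single (Γ.chipParam a e) 1 else 0)
        = a e := by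
      have h1 : a e = (⌊a e / Γ.len e⌋ + Int.fract (a e / Γ.len e)) * Γ.len e := by
        rw [Int.floor_add_fract]; field_simp
      split_ifs with h
      · have hf := fract_pos_of_chipParam_mem h
        rw [neg_div] at hf
        rw [hinge_single, max_eq_right (by linarith [h.2]), chipParam, neg_div,
          Int.fract_neg fun h0 => by rw [Int.fract_neg_eq_zero.2 h0] at hf; exact lt_irrefl _ hf]
        push_cast
        linarith
      · have hf := fract_eq_zero_of_chipParam_notMem h
        rw [neg_div, Int.fract_neg_eq_zero] at hf
        rw [hf] at h1
        simp only [map_zero]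
        linarith
    simp only [Pi.neg_apply]
    push_cast
    linarith
  · rw [Finsupp.sub_apply, config_vertex, vertexCoeff, baseCoeff, Fintype.sum_prod_type]
    have : ∀ e, ((if Γ.src e = v then total (restr e D) else 0) +
        ∑ b : Bool, if Γ.near (e, b) = v then ⌊Γ.dartSlope a (e, b)⌋ else 0) =
        -((if Γ.src e = v then -(total (restr e D) + ⌊a e / Γ.len e⌋) else 0) -
      (if Γ.tgt e = v then -(total (restr e D) + ⌊a e / Γ.len e⌋) + total (restr e
        (D - Γ.config (Γ.vertexCoeff (baseCoeff D) a) (Γ.chipParam a))) else 0)) := by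
      intro e
      rw [map_sub, map_sub, restr_config]
      -- The floors of the slopes in the two directions add up to minus the number of chips inside
      -- the edge.
      have hfl : ⌊-a e / Γ.len e⌋ = -⌊a e / Γ.len e⌋ - total
          (if Γ.chipParam a e ∈ Ioo 0 (Γ.len e) then Finsupp.single (Γ.chipParam a e) 1 else 0) := by
        have h1 := Int.floor_add_fract (a e / Γ.len e)
        have h2 := Int.floor_add_fract (-a e / Γ.len e)
        split_ifs with h
        · have hf := fract_pos_of_chipParam_mem h
          rw [neg_div] at hf
          have := Int.fract_neg fun h0 => by
            rw [Int.fract_neg_eq_zero.2 h0] at hf; exact lt_irrefl _ hf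
          rw [neg_div, this] at h2
          rw [total_single, neg_div]
          have h3 : ((⌊-(a e / Γ.len e)⌋ : ℤ) : ℝ) = ((-⌊a e / Γ.len e⌋ - 1 : ℤ) : ℝ) := by
            push_cast; linarith
          exact_mod_cast h3
        · have hf := fract_eq_zero_of_chipParam_notMem h
          rw [hf] at h2
          rw [neg_div, Int.fract_neg_eq_zero] at hf
          rw [hf] at h1
          rw [map_zero, neg_div]
          rw [neg_div] at h2
          have h3 : ((⌊-(a e / Γ.len e)⌋ : ℤ) : ℝ) = ((-⌊a e / Γ.len e⌋ - 0 : ℤ) : ℝ) := by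
            push_cast; linarith
          exact_mod_cast h3
      simp only [Fintype.sum_bool, near, dartSlope, if_true, Bool.false_eq_true, if_false]
      rw [hfl]
      split_ifs <;> ring
    have h2 := Finset.sum_congr rfl fun e (_ : e ∈ Finset.univ) => this e
    rw [Finset.sum_add_distrib, Finset.sum_neg_distrib] at h2
    linarith

end NormalForm

/-! ### The graph Laplacian and its maximum principle -/

section Laplacian

variable {V E : Type*} [Fintype V] [Fintype E] {Γ : MetricGraph V E}

open Classical in
/-- The Laplacian of a function on the vertices. -/
noncomputable def laplacian (Γ : MetricGraph V E) (φ : V → ℝ) (v : V) : ℝ :=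
  ∑ h : E × Bool, if Γ.near h = v then (φ (Γ.far h) - φ (Γ.near h)) / Γ.len h.1 else 0

omit [Fintype V] in
lemma laplacian_sub (φ ψ : V → ℝ) (v : V) :
    Γ.laplacian (φ - ψ) v = Γ.laplacian φ v - Γ.laplacian ψ v := by
  simp only [laplacian, ← Finset.sum_sub_distrib]
  refine Finset.sum_congr rfl fun h _ => ?_
  split_ifs
  · simp only [Pi.sub_apply]; ring
  · simp

omit [Fintype V] [Fintype E] in
lemma iff_of_adjacent (p : V → Prop) (hp : ∀ h : E × Bool, p (Γ.near h) → p (Γ.far h)) (u v : V) :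
    p u ↔ p v := by
  induction Γ.connected u v with
  | rel x y h =>
    obtain ⟨e, rfl, rfl⟩ := h
    exact ⟨hp (e, false), hp (e, true)⟩
  | refl => rfl
  | symm _ _ _ ih => exact ih.symm
  | trans _ _ _ _ _ ih1 ih2 => exact ih1.trans ih2

/-- At a maximum other than `u` all summands of the Laplacian are nonpositive, so they vanish. By
connectedness the maximum would spread along edges to `u`. -/
lemma le_of_laplacian_nonneg {φ : V → ℝ} {u : V} (h : ∀ v ≠ u, 0 ≤ Γ.laplacian φ v) (v : V) :
    φ v ≤ φ u := by
  classical
  obtain ⟨w, -, hw⟩ := Finset.exists_max_image Finset.univ φ ⟨u, Finset.mem_univ u⟩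
  suffices φ u = φ w by rw [this]; exact hw v (Finset.mem_univ v)
  by_contra hne
  refine hne ((iff_of_adjacent (Γ := Γ) (fun x => φ x = φ w) (fun d hd => ?_) w u).1 rfl)
  have hnu : Γ.near d ≠ u := fun hh => hne (hh ▸ hd)
  have hterm : ∀ d' ∈ Finset.univ, (if Γ.near d' = Γ.near d then
      (φ (Γ.far d') - φ (Γ.near d')) / Γ.len d'.1 else 0) ≤ 0 := by
    intro d' _
    split_ifs with hd'
    · rw [hd', hd]
      exact div_nonpos_of_nonpos_of_nonneg (sub_nonpos.2 (hw _ (Finset.mem_univ _)))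
        (Γ.len_pos _).le
    · exact le_rfl
  have hzero : Γ.laplacian φ (Γ.near d) = 0 := le_antisymm (by
    unfold laplacian; convert Finset.sum_nonpos hterm) (h _ hnu)
  have := (Finset.sum_eq_zero_iff_of_nonpos hterm).1 (by unfold laplacian at hzero; convert hzero)
    d (Finset.mem_univ d)
  rw [if_pos rfl, div_eq_zero_iff] at this
  rcases this with h' | h'
  · rw [← hd]; linarith
  · exact absurd h' (Γ.len_pos _).ne'

/-- A Dirichlet problem with one boundary vertex: the homogeneous system has only the zero solution
by the maximum principle, and the system is square. -/
lemma exists_laplacian_eq (u : V) (k : V → ℝ) :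
    ∃ φ : V → ℝ, φ u = 0 ∧ ∀ v ≠ u, Γ.laplacian φ v = k v := by
  classical
  let L : (V → ℝ) →ₗ[ℝ] (V → ℝ) :=
    { toFun := fun φ v => if v = u then φ u else Γ.laplacian φ v
      map_add' := fun φ ψ => by
        ext v
        simp only [Pi.add_apply]
        split_ifs
        · rfl
        · simp only [laplacian, ← Finset.sum_add_distrib]
          refine Finset.sum_congr rfl fun h _ => ?_
          split_ifs
          · simp only [Pi.add_apply]; ring
          · simp
      map_smul' := fun r φ => by
        ext v
        simp only [Pi.smul_apply, smul_eq_mul, RingHom.id_apply]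
        split_ifs
        · rfl
        · simp only [laplacian, Finset.mul_sum]
          refine Finset.sum_congr rfl fun h _ => ?_
          split_ifs
          · simp only [Pi.smul_apply, smul_eq_mul]; ring
          · simp }
  have hL : Function.Injective L := by
    rw [← LinearMap.ker_eq_bot, LinearMap.ker_eq_bot']
    intro φ hφ
    have h0 : φ u = 0 := by simpa [L] using congrFun hφ u
    have h1 : ∀ v ≠ u, Γ.laplacian φ v = 0 := fun v hv => by simpa [L, hv] using congrFun hφ v
    have h2 : ∀ v ≠ u, Γ.laplacian (0 - φ) v = 0 := fun v hv => by
      rw [laplacian_sub, h1 v hv]; simp [laplacian]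
    ext v
    have h3 := le_of_laplacian_nonneg (fun v hv => (h1 v hv).ge) v
    have h4 := le_of_laplacian_nonneg (fun v hv => (h2 v hv).ge) v
    simp only [Pi.sub_apply, Pi.zero_apply] at h4 ⊢
    linarith
  obtain ⟨φ, hφ⟩ := LinearMap.injective_iff_surjective.1 hL (fun v => if v = u then 0 else k v)
  refine ⟨φ, by simpa [L] using congrFun hφ u, fun v hv => by simpa [L, hv] using congrFun hφ v⟩

end Laplacian

/-! ### Reduced divisors and Dhar's burning algorithm -/

section Burning

variable {V E : Type*} [Fintype V] [Fintype E] {Γ : MetricGraph V E}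

/-- `U` is the unburnt set, and the hypothesis says that the fire always advances. The next vertex
`v` gets time `1` and the times on `U \ {v}` are shifted by one; everything outside `U` has time
`0`. At the start only `u` is outside, which gives injectivity. -/
lemma exists_burning_order {n : V → ℤ} {G : Set (E × Bool)} {u : V}
    (h : ∀ U : Finset V, U.Nonempty → u ∉ U → ∃ v ∈ U,
      n v + 1 ≤ {d | Γ.near d = v ∧ Γ.far d ∉ U ∧ d ∈ G}.ncard) :
    ∃ ρ : V → ℕ, Function.Injective ρ ∧ ∀ v ≠ u,
      n v + 1 ≤ {d | Γ.near d = v ∧ ρ (Γ.far d) < ρ v ∧ d ∈ G}.ncard := by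
  classical
  have key : ∀ (k : ℕ) (U : Finset V), U.card = k → u ∉ U → ∃ ρ : V → ℕ, (∀ w ∉ U, ρ w = 0) ∧
      (∀ w ∈ U, 0 < ρ w) ∧ Set.InjOn ρ U ∧ ∀ v ∈ U,
      n v + 1 ≤ {d | Γ.near d = v ∧ ρ (Γ.far d) < ρ v ∧ d ∈ G}.ncard := by
    intro k
    induction k with
    | zero =>
      intro U hU _
      rw [Finset.card_eq_zero] at hU
      subst hU
      exact ⟨0, by simp, by simp, by simp, by simp⟩
    | succ k ih =>
      intro U hU huU
      obtain ⟨v, hv, hcard⟩ := h U (Finset.card_pos.1 (by omega)) huU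
      obtain ⟨ρ, h0, hpos, hinj, hρ⟩ := ih (U.erase v) (by rw [Finset.card_erase_of_mem hv]; omega)
        fun hh => huU (Finset.mem_of_mem_erase hh)
      have hvn : v ∉ U.erase v := Finset.notMem_erase v U
      let ρ' : V → ℕ := fun w => if w ∈ U.erase v then ρ w + 1 else if w = v then 1 else 0
      have e1 : ∀ w ∈ U.erase v, ρ' w = ρ w + 1 := fun w hw => if_pos hw
      have e2 : ρ' v = 1 := by simp [ρ']
      have e3 : ∀ w ∉ U, ρ' w = 0 := fun w hw => by
        have h1 : w ∉ U.erase v := fun hh => hw (Finset.mem_of_mem_erase hh)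
        have h2 : w ≠ v := fun hh => hw (hh ▸ hv)
        simp only [ρ', if_neg h1, if_neg h2]
      have hU' : ∀ w ∈ U, w = v ∨ w ∈ U.erase v := fun w hw => by
        by_cases hwv : w = v
        · exact Or.inl hwv
        · exact Or.inr (Finset.mem_erase.2 ⟨hwv, hw⟩)
      refine ⟨ρ', e3, fun w hw => ?_, fun x hx y hy hxy => ?_, fun w hw => ?_⟩
      · rcases hU' w hw with rfl | h1
        · omega
        · rw [e1 w h1]; omega
      · rcases hU' x hx with rfl | h1 <;> rcases hU' y hy with rfl | h2
        · rfl
        · have := hpos y h2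
          rw [e2, e1 y h2] at hxy; omega
        · have := hpos x h1
          rw [e2, e1 x h1] at hxy; omega
        · rw [e1 x h1, e1 y h2] at hxy
          exact hinj h1 h2 (by omega)
      · rcases hU' w hw with rfl | h1
        · refine hcard.trans ?_
          refine Int.ofNat_le.2 (Set.ncard_le_ncard ?_ (Set.toFinite _))
          rintro d ⟨hd1, hd2, hd3⟩
          exact ⟨hd1, by rw [e2, e3 _ hd2]; omega, hd3⟩
        · refine (hρ w h1).trans ?_
          refine Int.ofNat_le.2 (Set.ncard_le_ncard ?_ (Set.toFinite _))
          rintro d ⟨hd1, hd2, hd3⟩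
          refine ⟨hd1, ?_, hd3⟩
          rw [e1 w h1]
          by_cases hf : Γ.far d ∈ U
          · rcases hU' _ hf with h2 | h2
            · rw [h2, e2]; have := hpos w h1; omega
            · rw [e1 _ h2]; omega
          · rw [e3 _ hf]; omega
  obtain ⟨ρ, h0, hpos, hinj, hρ⟩ := key _ (Finset.univ.erase u) rfl (by simp)
  refine ⟨ρ, fun x y hxy => ?_, fun v hv => hρ v (by simp [hv])⟩
  by_cases hx : x = u <;> by_cases hy : y = u
  · rw [hx, hy]
  · have h1 := h0 x (by simp [hx])
    have h2 := hpos y (by simp [hy])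
    omega
  · have h1 := h0 y (by simp [hy])
    have h2 := hpos x (by simp [hx])
    omega
  · exact hinj (by simp [hx]) (by simp [hy]) hxy

-- The floor is upper semicontinuous, so a negative coefficient stays negative under small changes
-- of `φ`.
omit [Fintype V] in
lemma isClosed_vertexCoeff_nonneg (n : V → ℤ) (c : E → ℝ) (v : V) :
    IsClosed {φ : V → ℝ | 0 ≤ Γ.vertexCoeff n
      (fun e => c e + (φ (Γ.tgt e) - φ (Γ.src e))) v} := by
  classical
  rw [← isOpen_compl_iff, isOpen_iff_mem_nhds]
  intro φ hφ
  simp only [mem_compl_iff, mem_ofPred_eq, not_le] at hφ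
  have hev : ∀ᶠ ψ in 𝓝 φ, ∀ h ∈ (Finset.univ : Finset (E × Bool)),
      ⌊Γ.dartSlope (fun e => c e + (ψ (Γ.tgt e) - ψ (Γ.src e))) h⌋ ≤
      ⌊Γ.dartSlope (fun e => c e + (φ (Γ.tgt e) - φ (Γ.src e))) h⌋ := by
    rw [Finset.eventually_all]
    intro h _
    have hcont : Continuous fun ψ : V → ℝ =>
        Γ.dartSlope (fun e => c e + (ψ (Γ.tgt e) - ψ (Γ.src e))) h := by
      unfold dartSlope
      split_ifs <;> fun_prop
    filter_upwards [hcont.continuousAt.eventually_lt continuousAt_const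
      (Int.lt_floor_add_one (Γ.dartSlope (fun e => c e + (φ (Γ.tgt e) - φ (Γ.src e))) h))]
      with ψ hψ
    exact Int.lt_add_one_iff.1 (Int.floor_lt.2 (by exact_mod_cast hψ))
  filter_upwards [hev] with ψ hψ
  simp only [mem_compl_iff, mem_ofPred_eq, not_le]
  refine lt_of_le_of_lt ?_ hφ
  unfold vertexCoeff
  refine add_le_add_right (Finset.sum_le_sum fun h hh => ?_) _
  split_ifs
  · exact hψ h hh
  · exact le_rfl

omit [Fintype V] [Fintype E] in
lemma dartSlope_add (c : E → ℝ) (φ : V → ℝ) (h : E × Bool) :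
    Γ.dartSlope (fun e => c e + (φ (Γ.tgt e) - φ (Γ.src e))) h =
      Γ.dartSlope c h + (φ (Γ.far h) - φ (Γ.near h)) / Γ.len h.1 := by
  rcases h with ⟨e, b⟩
  cases b <;> simp [dartSlope, near, far] <;> ring

/-- A maximal function among those for which the coefficients off `u` are nonnegative. -/
lemma exists_reduced (n : V → ℤ) (c : E → ℝ) (u : V) : ∃ φ : V → ℝ,
    (∀ v ≠ u, 0 ≤ Γ.vertexCoeff n (fun e => c e + (φ (Γ.tgt e) - φ (Γ.src e))) v) ∧
    ∀ ψ : V → ℝ, ψ u = φ u → (∀ v, φ v ≤ ψ v) →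
      (∀ v ≠ u, 0 ≤ Γ.vertexCoeff n (fun e => c e + (ψ (Γ.tgt e) - ψ (Γ.src e))) v) → ψ = φ := by
  classical
  -- Dropping the floors bounds the coefficients from above, and subtracting one from each slope
  -- bounds them from below; both bounds are a constant plus the Laplacian.
  have hcoeff : ∀ φ v, (Γ.vertexCoeff n (fun e => c e + (φ (Γ.tgt e) - φ (Γ.src e))) v : ℝ) ≤
      n v + (∑ h, if Γ.near h = v then Γ.dartSlope c h else 0) + Γ.laplacian φ v := by
    intro φ v
    rw [vertexCoeff, laplacian, add_assoc, ← Finset.sum_add_distrib]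
    push_cast
    refine add_le_add_right (Finset.sum_le_sum fun h _ => ?_) _
    split_ifs
    · rw [← dartSlope_add]; exact Int.floor_le _
    · simp
  have hcoeff' : ∀ φ v, n v + (∑ h, if Γ.near h = v then Γ.dartSlope c h - 1 else 0) +
      Γ.laplacian φ v ≤ Γ.vertexCoeff n (fun e => c e + (φ (Γ.tgt e) - φ (Γ.src e))) v := by
    intro φ v
    rw [vertexCoeff, laplacian, add_assoc, ← Finset.sum_add_distrib]
    push_cast
    refine add_le_add_right (Finset.sum_le_sum fun h _ => ?_) _
    split_ifs
    · have h1 := dartSlope_add (Γ := Γ) c φ h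
      have h2 := Int.lt_floor_add_one
        (Γ.dartSlope (fun e => c e + (φ (Γ.tgt e) - φ (Γ.src e))) h)
      linarith
    · simp
  -- `φ₀` makes the lower bound vanish, so it is admissible; `g` makes the upper bound vanish, so by
  -- the maximum principle it dominates every admissible function that is zero at `u`.
  obtain ⟨φ₀, h00, h0⟩ := exists_laplacian_eq (Γ := Γ) u
    fun v => -(n v + ∑ h, if Γ.near h = v then Γ.dartSlope c h - 1 else 0)
  obtain ⟨g, hg0, hg⟩ := exists_laplacian_eq (Γ := Γ) u
    fun v => -(n v + ∑ h, if Γ.near h = v then Γ.dartSlope c h else 0)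
  let K : Set (V → ℝ) := Icc φ₀ g ∩ ({φ | φ u = 0} ∩ ⋂ v : V, ⋂ _ : v ≠ u, {φ : V → ℝ |
    0 ≤ Γ.vertexCoeff n (fun e => c e + (φ (Γ.tgt e) - φ (Γ.src e))) v})
  have hle : ∀ φ : V → ℝ, φ u = 0 →
      (∀ v ≠ u, 0 ≤ Γ.vertexCoeff n (fun e => c e + (φ (Γ.tgt e) - φ (Γ.src e))) v) → φ ≤ g := by
    intro φ hφ0 hφ v
    have h1 : ∀ v ≠ u, 0 ≤ Γ.laplacian (φ - g) v := by
      intro v hv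
      rw [laplacian_sub, hg v hv]
      have h2 : (0 : ℝ) ≤ Γ.vertexCoeff n (fun e => c e + (φ (Γ.tgt e) - φ (Γ.src e))) v := by
        exact_mod_cast hφ v hv
      have h3 := hcoeff φ v
      linarith
    have := le_of_laplacian_nonneg h1 v
    simp only [Pi.sub_apply, hφ0, hg0] at this
    linarith
  have hK : IsCompact K := by
    refine isCompact_Icc.inter_right ?_
    refine (isClosed_eq (continuous_apply u) continuous_const).inter ?_
    exact isClosed_iInter fun v => isClosed_iInter fun _ => isClosed_vertexCoeff_nonneg n c v
  have h0K : ∀ v ≠ u, 0 ≤ Γ.vertexCoeff n (fun e => c e + (φ₀ (Γ.tgt e) - φ₀ (Γ.src e))) v := by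
    intro v hv
    have h1 := hcoeff' φ₀ v
    rw [h0 v hv] at h1
    have : (0 : ℝ) ≤ Γ.vertexCoeff n (fun e => c e + (φ₀ (Γ.tgt e) - φ₀ (Γ.src e))) v := by
      linarith
    exact_mod_cast this
  have hne : K.Nonempty := ⟨φ₀, ⟨le_rfl, hle φ₀ h00 h0K⟩, h00, by simpa using h0K⟩
  -- A maximizer of the sum of the values has no admissible function above it with the same value at
  -- `u`.
  obtain ⟨φ, ⟨⟨hφ0, -⟩, hφu, hφ⟩, hmax⟩ := hK.exists_isMaxOn hne
    (f := fun φ : V → ℝ => ∑ v, φ v) (by fun_prop)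
  refine ⟨φ, by simpa using hφ, fun ψ hψu hψ hψc => ?_⟩
  have hψu' : ψ u = 0 := hψu.trans hφu
  have hψK : ψ ∈ K := ⟨⟨hφ0.trans hψ, hle ψ hψu' hψc⟩, hψu', by simpa using hψc⟩
  have h1 : ∑ v, ψ v ≤ ∑ v, φ v := hmax hψK
  have h2 := (Finset.sum_eq_sum_iff_of_le fun v _ => hψ v).1
    (le_antisymm (Finset.sum_le_sum fun v _ => hψ v) h1)
  ext v
  exact (h2 v (Finset.mem_univ v)).symm

-- Otherwise `U` could be fired. Raising `φ` slightly on `U` costs a vertex of `U` at most one chip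
-- for each chip-free dart leaving `U`, since a slope that is not an integer keeps its floor.
-- Vertices outside `U` lose nothing. So the coefficients stay nonnegative, against maximality.
omit [Fintype V] in
lemma burn_of_reduced {n : V → ℤ} {c : E → ℝ} {u : V} {φ : V → ℝ}
    (hφ : ∀ v ≠ u, 0 ≤ Γ.vertexCoeff n (fun e => c e + (φ (Γ.tgt e) - φ (Γ.src e))) v)
    (hmax : ∀ ψ : V → ℝ, ψ u = φ u → (∀ v, φ v ≤ ψ v) →
      (∀ v ≠ u, 0 ≤ Γ.vertexCoeff n (fun e => c e + (ψ (Γ.tgt e) - ψ (Γ.src e))) v) → ψ = φ)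
    (U : Finset V) (hU : U.Nonempty) (huU : u ∉ U) : ∃ v ∈ U,
      Γ.vertexCoeff n (fun e => c e + (φ (Γ.tgt e) - φ (Γ.src e))) v + 1 ≤
      {d : E × Bool | Γ.near d = v ∧ Γ.far d ∉ U ∧ d ∈ {d : E × Bool | Γ.chipParam
        (fun e => c e + (φ (Γ.tgt e) - φ (Γ.src e))) d.1 ∉ Ioo 0 (Γ.len d.1)}}.ncard := by
  classical
  by_contra! hcon
  set a : E → ℝ := fun e => c e + (φ (Γ.tgt e) - φ (Γ.src e)) with ha
  -- For such `ε` the floor of a nonintegral slope does not drop, and that of an integral slope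
  -- drops by at most one.
  obtain ⟨ε, hε, hε'⟩ : ∃ ε > 0, ∀ h : E × Bool,
      ε / Γ.len h.1 < Γ.dartSlope a h - (⌈Γ.dartSlope a h⌉ - 1) := by
    have : ∀ᶠ ε in 𝓝[>] (0 : ℝ), ∀ h ∈ (Finset.univ : Finset (E × Bool)),
        ε / Γ.len h.1 < Γ.dartSlope a h - (⌈Γ.dartSlope a h⌉ - 1) := by
      rw [Finset.eventually_all]
      intro h _
      have hpos : 0 < Γ.dartSlope a h - (⌈Γ.dartSlope a h⌉ - 1) := by
        have := Int.ceil_lt_add_one (Γ.dartSlope a h)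
        linarith
      filter_upwards [Ioo_mem_nhdsGT (mul_pos hpos (Γ.len_pos h.1))] with ε hε
      rw [div_lt_iff₀ (Γ.len_pos h.1)]
      exact hε.2
    obtain ⟨ε, h1, h2⟩ := (this.and self_mem_nhdsWithin).exists
    exact ⟨ε, h2, fun h => h1 h (Finset.mem_univ h)⟩
  let ψ : V → ℝ := fun v => φ v + if v ∈ U then ε else 0
  have hψ : ψ = φ := by
    refine hmax ψ (by simp [ψ, huU]) (fun v => ?_) fun v hv => ?_
    · simp only [ψ]; split_ifs <;> linarith
    · have hslope : ∀ h, Γ.dartSlope (fun e => c e + (ψ (Γ.tgt e) - ψ (Γ.src e))) h =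
          Γ.dartSlope a h + ((if Γ.far h ∈ U then ε else 0) - (if Γ.near h ∈ U then ε else 0)) /
            Γ.len h.1 := by
        intro h
        rw [dartSlope_add, ha, dartSlope_add]
        simp only [ψ]
        ring
      by_cases hvU : v ∈ U
      · have h1 := hcon v hvU
        have h2 : (({d : E × Bool | Γ.near d = v ∧ Γ.far d ∉ U ∧ d ∈ {d : E × Bool |
            Γ.chipParam a d.1 ∉ Ioo 0 (Γ.len d.1)}}.ncard : ℕ) : ℤ) =
            ∑ h : E × Bool, if Γ.near h = v ∧ Γ.far h ∉ U ∧
              Γ.chipParam a h.1 ∉ Ioo 0 (Γ.len h.1) then 1 else 0 := by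
          rw [Set.ncard_eq_toFinset_card', ← Finset.natCast_card_filter]
          congr 2
          ext d; simp
        rw [h2] at h1
        have h3 : Γ.vertexCoeff n a v - (∑ h : E × Bool, if Γ.near h = v ∧ Γ.far h ∉ U ∧
              Γ.chipParam a h.1 ∉ Ioo 0 (Γ.len h.1) then 1 else 0) ≤
            Γ.vertexCoeff n (fun e => c e + (ψ (Γ.tgt e) - ψ (Γ.src e))) v := by
          rw [vertexCoeff, vertexCoeff, add_sub_assoc, ← Finset.sum_sub_distrib]
          refine add_le_add_right (Finset.sum_le_sum fun h _ => ?_) _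
          by_cases hnear : Γ.near h = v
          · rw [if_pos hnear, if_pos hnear, hslope h, hnear, if_pos hvU]
            by_cases hfar : Γ.far h ∈ U
            · rw [if_pos hfar, if_neg fun hh => hh.2.1 hfar]; simp
            · rw [if_neg hfar]
              have h4 := hε' h
              have h5 : ⌈Γ.dartSlope a h⌉ - 1 ≤
                  ⌊Γ.dartSlope a h + (0 - ε) / Γ.len h.1⌋ := by
                rw [Int.le_floor]
                push_cast
                have : (0 - ε) / Γ.len h.1 = -(ε / Γ.len h.1) := by ring
                rw [this]; linarith
              split_ifs with h6
              · have := Int.floor_le_ceil (Γ.dartSlope a h); omega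
              · have h7 : Γ.chipParam a h.1 ∈ Ioo 0 (Γ.len h.1) := by
                  by_contra h8; exact h6 ⟨rfl, hfar, h8⟩
                have h9 := fract_pos_of_chipParam_mem h7
                have h10 : ⌊Γ.dartSlope a h⌋ < ⌈Γ.dartSlope a h⌉ := by
                  by_contra hc
                  obtain ⟨z, hz⟩ : ∃ z : ℤ, (z : ℝ) = Γ.dartSlope a h := by
                    refine ⟨⌊Γ.dartSlope a h⌋, le_antisymm (Int.floor_le _) ?_⟩
                    exact (Int.le_ceil _).trans (by exact_mod_cast not_lt.1 hc)
                  have : ∃ w : ℤ, -a h.1 / Γ.len h.1 = w := by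
                    rcases hb : h.2 with _ | _
                    · simp only [dartSlope, hb, Bool.false_eq_true, if_false] at hz
                      exact ⟨-z, by rw [neg_div, ← hz]; simp⟩
                    · simp only [dartSlope, hb, if_true] at hz
                      exact ⟨z, hz.symm⟩
                  obtain ⟨w, hw⟩ := this
                  rw [hw, Int.fract_intCast] at h9
                  exact lt_irrefl _ h9
                omega
          · rw [if_neg hnear, if_neg hnear, if_neg fun hh => hnear hh.1]; simp
        omega
      · refine (hφ v hv).trans ?_
        unfold vertexCoeff
        refine add_le_add_right (Finset.sum_le_sum fun h _ => ?_) _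
        by_cases hnear : Γ.near h = v
        · rw [if_pos hnear, if_pos hnear, hslope h, hnear, if_neg hvU]
          refine Int.floor_le_floor (le_add_of_nonneg_right ?_)
          have := (Γ.len_pos h.1).le
          split_ifs
          · rw [sub_zero]; positivity
          · simp
        · rw [if_neg hnear, if_neg hnear]
  obtain ⟨v, hv⟩ := hU
  have := congrFun hψ v
  simp only [ψ, if_pos hv] at this
  linarith

/-- Reduced divisors exist, and can be burnt from the base vertex `u`. -/
theorem exists_reduced_config (D : Γ.Divisor) (u : V) : ∃ (n : V → ℤ) (τ : E → ℝ) (ρ : V → ℕ),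
    LinEquiv D (Γ.config n τ) ∧ (∀ e, τ e ∈ Ico 0 (Γ.len e)) ∧ (∀ v ≠ u, 0 ≤ n v) ∧
    Function.Injective ρ ∧ ∀ v ≠ u, n v + 1 ≤ {h : E × Bool | Γ.near h = v ∧
      ρ (Γ.far h) < ρ v ∧ τ h.1 ∉ Ioo 0 (Γ.len h.1)}.ncard := by
  obtain ⟨φ, hφ, hmax⟩ := exists_reduced (Γ := Γ) (baseCoeff D) (baseShift D) u
  obtain ⟨ρ, hinj, hρ⟩ := exists_burning_order (burn_of_reduced hφ hmax)
  exact ⟨_, _, ρ, linEquiv_config D φ _ fun e => rfl, chipParam_mem _, hφ, hinj, hρ⟩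

/-- A nonnegative coefficient at `u` would make the reduced divisor effective, so it is negative and
the burning condition at `u` is free. Every other vertex has a nonnegative coefficient, hence a dart
through which it burns; following such darts leads back to `u` along chip-free edges. -/
theorem exists_burns_of_linearSystem_eq_empty [Nonempty V] {D : Γ.Divisor}
    (hD : linearSystem D = ∅) : ∃ (n : V → ℤ) (τ : E → ℝ) (ρ : V → ℕ),
    LinEquiv D (Γ.config n τ) ∧ (∀ e, τ e ∈ Ico 0 (Γ.len e)) ∧ Function.Injective ρ ∧
    Γ.Burns n τ ρ ∅ ∧ ∀ v w, Γ.JoinedBy {e | τ e ∉ Ioo 0 (Γ.len e)} v w := by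
  obtain ⟨u⟩ := ‹Nonempty V›
  obtain ⟨n, τ, ρ, h1, h2, h3, h4, h5⟩ := exists_reduced_config D u
  have hu : n u < 0 := by
    by_contra hc
    rw [not_lt] at hc
    have : Γ.config n τ ∈ linearSystem D := by
      refine ⟨fun p => ?_, h1.symm⟩
      cases p with
      | vertex v =>
        rw [config_vertex]
        by_cases hv : v = u
        · rw [hv]; exact hc
        · exact h3 v hv
      | inner e t =>
        classical
        rw [config_inner]
        split_ifs <;> simp
    rw [hD] at this
    exact this
  refine ⟨n, τ, ρ, h1, h2, h4, fun v => ?_, ?_⟩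
  · by_cases hv : v = u
    · rw [hv]; omega
    · simpa using h5 v hv
  · have key : ∀ (k : ℕ) (v : V), ρ v ≤ k → Γ.JoinedBy {e | τ e ∉ Ioo 0 (Γ.len e)} v u := by
      intro k
      induction k with
      | zero =>
        intro v hk
        by_cases hv : v = u
        · rw [hv]; exact Relation.EqvGen.refl u
        · have h6 := h5 v hv
          have h7 := h3 v hv
          obtain ⟨d, -, hd, -⟩ : {h : E × Bool | Γ.near h = v ∧
              ρ (Γ.far h) < ρ v ∧ τ h.1 ∉ Ioo 0 (Γ.len h.1)}.Nonempty :=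
            Set.nonempty_of_ncard_ne_zero (by omega)
          omega
      | succ k ih =>
        intro v hk
        by_cases hv : v = u
        · rw [hv]; exact Relation.EqvGen.refl u
        · have h6 := h5 v hv
          have h7 := h3 v hv
          obtain ⟨⟨e, b⟩, hd1, hd2, hd3⟩ : {h : E × Bool | Γ.near h = v ∧
              ρ (Γ.far h) < ρ v ∧ τ h.1 ∉ Ioo 0 (Γ.len h.1)}.Nonempty :=
            Set.nonempty_of_ncard_ne_zero (by omega)
          refine Relation.EqvGen.trans _ _ _ ?_ (ih (Γ.far (e, b)) (by omega))
          subst hd1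
          cases b
          · exact Relation.EqvGen.rel _ _ ⟨e, hd3, rfl, rfl⟩
          · exact Relation.EqvGen.symm _ _ (Relation.EqvGen.rel _ _ ⟨e, hd3, rfl, rfl⟩)
    exact fun v w => (key _ v le_rfl).trans _ _ _ ((key _ w le_rfl).symm _ _)

end Burning

end MetricGraph

namespace MetricGraph

/-! ### Moving two chips of an edge -/

section EdgeMoves

variable {V E : Type*} {Γ : MetricGraph V E}

open Classical in
lemma restr_chip (e e' : E) (s : ℝ) :
    restr e' (Γ.chip e s) = if e = e' ∧ s ∈ Ioo 0 (Γ.len e) then Finsupp.single s 1 else 0 := by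
  by_cases h : s ∈ Ioo 0 (Γ.len e)
  · rw [chip_of_mem h, Γ.pt_of_mem h, restr_single_inner]
    simp only [h, and_true]
  · rw [chip_of_notMem h, map_zero, if_neg fun hh => h hh.2]

variable [Fintype E]

open Classical in
lemma isPrincipal_of_edge {Δ : Γ.Divisor} (e : E) (m : ℤ) (h : ∀ e' ≠ e, restr e' Δ = 0)
    (hm : m * Γ.len e + hinge (Γ.len e) (restr e Δ) = 0)
    (hv : ∀ v, Δ (.vertex v) =
      (if Γ.src e = v then m else 0) - (if Γ.tgt e = v then m + total (restr e Δ) else 0)) :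
    IsPrincipal Δ := by
  refine ⟨0, fun e' => if e' = e then m else 0, fun e' => ?_, fun v => ?_⟩
  · by_cases he : e' = e
    · subst he; simp [hm]
    · simp [he, h e' he]
  · rw [hv, Finset.sum_eq_single e]
    · simp
    · intro e' _ he
      simp [he, h e' he]
    · simp

/-- The positions of two chips of an edge can be added. -/
noncomputable def mergeParam (Γ : MetricGraph V E) (e : E) (s q : ℝ) : ℝ :=
  if s + q < Γ.len e then s + q else s + q - Γ.len e

/-- Two chips move apart at equal speed until one reaches an end. This lemma and the next two
distinguish whether the source, both ends at once, or the target is reached. -/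
lemma linEquiv_merge_lt {e : E} {s q : ℝ} (hs : s ∈ Ioo 0 (Γ.len e)) (hq : q ∈ Ioo 0 (Γ.len e))
    (h : s + q < Γ.len e) : LinEquiv (Γ.chip e s + Γ.chip e q)
      (Finsupp.single (.vertex (Γ.src e)) 1 + Γ.chip e (s + q)) := by
  classical
  have hsq : s + q ∈ Ioo 0 (Γ.len e) := ⟨add_pos hs.1 hq.1, h⟩
  rw [linEquiv_iff]
  refine isPrincipal_of_edge e (-1) (fun e' he => ?_) ?_ fun v => ?_
  · simp [restr_chip, Ne.symm he]
  · simp only [map_sub, map_add, restr_chip, hs, hq, hsq, and_self, if_true, restr_single_vertex,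
      hinge_single, map_zero]
    rw [max_eq_right (by linarith [hs.2]), max_eq_right (by linarith [hq.2]),
      max_eq_right (by linarith)]
    push_cast; ring
  · simp only [map_sub, map_add, restr_chip, hs, hq, hsq, and_self, if_true, restr_single_vertex,
      total_single, map_zero, Finsupp.sub_apply, Finsupp.add_apply, chip_vertex,
      Finsupp.single_apply, Point.vertex.injEq]
    split_ifs <;> simp

lemma linEquiv_merge_eq {e : E} {s q : ℝ} (hs : s ∈ Ioo 0 (Γ.len e)) (hq : q ∈ Ioo 0 (Γ.len e))
    (h : s + q = Γ.len e) : LinEquiv (Γ.chip e s + Γ.chip e q)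
      (Finsupp.single (.vertex (Γ.src e)) 1 + Finsupp.single (.vertex (Γ.tgt e)) 1) := by
  classical
  rw [linEquiv_iff]
  refine isPrincipal_of_edge e (-1) (fun e' he => ?_) ?_ fun v => ?_
  · simp [restr_chip, Ne.symm he]
  · simp only [map_sub, map_add, restr_chip, hs, hq, and_self, if_true, restr_single_vertex,
      hinge_single, map_zero]
    rw [max_eq_right (by linarith [hs.2]), max_eq_right (by linarith [hq.2])]
    push_cast; linarith
  · simp only [map_sub, map_add, restr_chip, hs, hq, and_self, if_true, restr_single_vertex,
      total_single, map_zero, Finsupp.sub_apply, Finsupp.add_apply, chip_vertex,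
      Finsupp.single_apply, Point.vertex.injEq]
    split_ifs <;> simp

lemma linEquiv_merge_gt {e : E} {s q : ℝ} (hs : s ∈ Ioo 0 (Γ.len e)) (hq : q ∈ Ioo 0 (Γ.len e))
    (h : Γ.len e < s + q) : LinEquiv (Γ.chip e s + Γ.chip e q)
      (Finsupp.single (.vertex (Γ.tgt e)) 1 + Γ.chip e (s + q - Γ.len e)) := by
  classical
  have hsq : s + q - Γ.len e ∈ Ioo 0 (Γ.len e) := ⟨by linarith, by linarith [hs.2, hq.2]⟩
  rw [linEquiv_iff]
  refine isPrincipal_of_edge e 0 (fun e' he => ?_) ?_ fun v => ?_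
  · simp [restr_chip, Ne.symm he]
  · simp only [map_sub, map_add, restr_chip, hs, hq, hsq, and_self, if_true, restr_single_vertex,
      hinge_single, map_zero]
    rw [max_eq_right (by linarith [hs.2]), max_eq_right (by linarith [hq.2]),
      max_eq_right (by linarith [hsq.2])]
    push_cast; ring
  · simp only [map_sub, map_add, restr_chip, hs, hq, hsq, and_self, if_true, restr_single_vertex,
      total_single, map_zero, Finsupp.sub_apply, Finsupp.add_apply, chip_vertex,
      Finsupp.single_apply, Point.vertex.injEq]
    split_ifs <;> simp

lemma LinEquiv.sum {ι : Type*} (S : Finset ι) {A B : ι → Γ.Divisor}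
    (h : ∀ i ∈ S, LinEquiv (A i) (B i)) : LinEquiv (∑ i ∈ S, A i) (∑ i ∈ S, B i) := by
  classical
  induction S using Finset.induction_on with
  | empty => simpa using LinEquiv.refl 0
  | insert i S hi ih =>
    rw [Finset.sum_insert hi, Finset.sum_insert hi]
    exact (h i (Finset.mem_insert_self i S)).add
      (ih fun j hj => h j (Finset.mem_insert_of_mem hj))

end EdgeMoves

/-! ### Moving a minimal divisor to the vertices and the loops -/

section RankDetermining

variable {V E : Type*} [Fintype V] [Fintype E] {Γ : MetricGraph V E}

lemma config_nonneg {n : V → ℤ} (hn : ∀ v, 0 ≤ n v) (τ : E → ℝ) : 0 ≤ Γ.config n τ := by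
  classical
  intro p
  cases p with
  | vertex v => rw [config_vertex]; exact hn v
  | inner e t => rw [config_inner]; split_ifs <;> simp

open Classical in
lemma config_update (n : V → ℤ) (τ : E → ℝ) (w : V) (k : ℤ) (e : E) (x : ℝ) :
    Γ.config (n + Pi.single w k) (Function.update τ e x) =
      Γ.config n τ + Finsupp.single (.vertex w) k - Γ.chip e (τ e) + Γ.chip e x := by
  ext p
  cases p with
  | vertex v =>
    simp [Finsupp.single_apply, Pi.single_apply, eq_comm]
  | inner e' t =>
    simp only [config_inner, Finsupp.add_apply, Finsupp.sub_apply, chip_inner,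
      Finsupp.single_apply, reduceCtorEq, if_false, Function.update_apply]
    by_cases he : e' = e
    · subst he; simp
    · simp [he, Ne.symm he]

omit [Fintype V] [Fintype E] in
open Classical in
lemma deg_chip (e : E) (s : ℝ) : deg (Γ.chip e s) = if s ∈ Ioo 0 (Γ.len e) then 1 else 0 := by
  unfold chip
  split_ifs
  · exact deg_single _ _
  · exact deg_zero

open Classical in
lemma deg_config (n : V → ℤ) (τ : E → ℝ) : deg (Γ.config n τ) =
    ∑ v, n v + ∑ e, if τ e ∈ Ioo 0 (Γ.len e) then 1 else 0 := by
  rw [config, deg_add, deg_sum, deg_sum]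
  simp only [deg_single, deg_chip]

lemma Burns.linearSystem_eq_empty [Nonempty V] {n : V → ℤ} {τ : E → ℝ} {ρ : V → ℕ}
    (h : Γ.Burns n τ ρ ∅) : linearSystem (Γ.config n τ) = ∅ := by
  obtain ⟨P, hP, hle⟩ := Burns.exists_permutation (Γ := Γ) (I := ∅) (σ := fun e => Γ.len e / 2)
    (fun e _ => by have := Γ.len_pos e; constructor <;> linarith) (by simp) (Z := ∅)
    (by simpa using h) (by simp)
  exact linearSystem_eq_empty_of_le_nu hP.2.1 (by simpa using hle)

/-- An effective divisor can be moved inside the edges so that at most one chip is left in the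
interior of every edge. -/
lemma exists_config_of_nonneg {F : Γ.Divisor} (hF : 0 ≤ F) : ∃ (a : V → ℤ) (s : E → ℝ),
    (∀ v, 0 ≤ a v) ∧ (∀ e, s e ∈ Ico 0 (Γ.len e)) ∧ LinEquiv F (Γ.config a s) := by
  classical
  -- With `φ = 0` chips move only inside their edges. The slope `baseShift / ℓ` lies between
  -- `-total` and `0`, so neither end of an edge receives a negative number of chips.
  refine ⟨_, _, fun v => ?_, chipParam_mem _, linEquiv_config F 0 (baseShift F) (by simp)⟩
  rw [vertexCoeff, baseCoeff, Fintype.sum_prod_type, add_assoc, ← Finset.sum_add_distrib]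
  refine add_nonneg (hF _) (Finset.sum_nonneg fun e _ => ?_)
  have hK : ∀ t, 0 ≤ restr e F t := by
    intro t
    by_cases ht : t ∈ Ioo 0 (Γ.len e)
    · have h1 := restr_apply e F ⟨t, ht⟩
      simp only at h1
      rw [h1]; exact hF _
    · rw [restr_eq_zero e F ht]
  have hl := Γ.len_pos e
  have h1 : -(total (restr e F) : ℝ) ≤ baseShift F e / Γ.len e := by
    rw [le_div_iff₀ hl, baseShift]
    have : 0 ≤ hinge (Γ.len e) (restr e F) := by
      rw [hinge_eq_sum]
      exact Finset.sum_nonneg fun t _ => mul_nonneg (by exact_mod_cast hK t) (le_max_left _ _)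
    linarith
  have h2 : 0 ≤ -baseShift F e / Γ.len e := by
    refine div_nonneg ?_ hl.le
    rw [baseShift, hinge_eq_total fun t ht => (mem_of_mem_support_restr ht).2.le]
    have : 0 ≤ ∑ t ∈ (restr e F).support, (restr e F t : ℝ) * t :=
      Finset.sum_nonneg fun t ht => mul_nonneg (by exact_mod_cast hK t)
        (mem_of_mem_support_restr ht).1.le
    linarith
  have h3 : -total (restr e F) ≤ ⌊baseShift F e / Γ.len e⌋ := by
    rw [Int.le_floor]; exact_mod_cast h1
  have h4 : 0 ≤ ⌊-baseShift F e / Γ.len e⌋ := Int.floor_nonneg.2 h2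
  simp only [Fintype.sum_bool, near, dartSlope, if_true, Bool.false_eq_true, if_false]
  split_ifs <;> omega

omit [Fintype V] [Fintype E] in
lemma near_not (e : E) (b : Bool) : Γ.near (e, !b) = Γ.far (e, b) := by cases b <;> rfl

omit [Fintype V] [Fintype E] in
lemma far_not (e : E) (b : Bool) : Γ.far (e, !b) = Γ.near (e, b) := by cases b <;> rfl

/-- A chip in the interior of an edge that is not a loop can be replaced by one of the ends. -/
theorem exists_end_of_linearSystem_eq_empty [Nonempty V] {G : Γ.Divisor} {e : E}
    (he : Γ.src e ≠ Γ.tgt e) {s : ℝ} (hs : s ∈ Ioo 0 (Γ.len e))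
    (hG : linearSystem (G - Γ.chip e s) = ∅) :
    ∃ w, linearSystem (G - Finsupp.single (.vertex w) 1) = ∅ := by
  classical
  obtain ⟨n, τ, ρ, heq, -, hinj, hburn, -⟩ := exists_burns_of_linearSystem_eq_empty hG
  have hGw : ∀ w A, LinEquiv (Γ.config n τ + Γ.chip e s) (A + Finsupp.single (.vertex w) 1) →
      linearSystem A = ∅ → linearSystem (G - Finsupp.single (.vertex w) 1) = ∅ := by
    intro w A h1 h2
    rw [← h2]
    apply LinEquiv.linearSystem_eq
    have h3 := (heq.add (LinEquiv.refl (Γ.chip e s))).trans h1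
    have h4 := h3.sub (LinEquiv.refl (Finsupp.single (.vertex w) 1))
    simpa using h4
  -- Directs `e` so that it ends at the vertex that burns earlier.
  obtain ⟨b, hb⟩ : ∃ b, ρ (Γ.far (e, b)) < ρ (Γ.near (e, b)) := by
    rcases lt_or_gt_of_ne (hinj.ne he) with h | h
    · exact ⟨true, h⟩
    · exact ⟨false, h⟩
  by_cases hτ : τ e ∈ Ioo 0 (Γ.len e)
  -- Burning depends only on whether `e` is blocked, not on where its chip lies. So if the merge
  -- sends one chip to an end, that end can be chosen.
  · have hkeep : ∀ x ∈ Ioo 0 (Γ.len e), linearSystem (Γ.config n (Function.update τ e x)) = ∅ := by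
      intro x hx
      refine Burns.linearSystem_eq_empty (ρ := ρ) fun v => ?_
      convert hburn v using 7 with h
      by_cases hh : h.1 = e
      · rw [hh, Function.update_self]; simp only [hx, hτ]
      · rw [Function.update_of_ne hh]
    have hupd : ∀ x, Γ.config n (Function.update τ e x) =
        Γ.config n τ - Γ.chip e (τ e) + Γ.chip e x := by
      intro x
      have := config_update (Γ := Γ) n τ (Γ.src e) 0 e x
      simpa using this
    rcases lt_trichotomy (s + τ e) (Γ.len e) with h | h | h
    · refine ⟨Γ.src e, hGw _ _ ?_ (hkeep (s + τ e) ⟨add_pos hs.1 hτ.1, h⟩)⟩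
      rw [hupd]
      have := (linEquiv_merge_lt hs hτ h).add (LinEquiv.refl (Γ.config n τ - Γ.chip e (τ e)))
      convert this using 1 <;> abel
    -- Both ends receive a chip. The one at the earlier end is subtracted; the one at the later end
    -- is paid for by `e`, which is now free to burn.
    · refine ⟨Γ.far (e, b), hGw _ (Γ.config (n + Pi.single (Γ.near (e, b)) 1)
        (Function.update τ e 0)) ?_ ?_⟩
      · rw [config_update]
        have h1 := (linEquiv_merge_eq hs hτ h).add (LinEquiv.refl (Γ.config n τ - Γ.chip e (τ e)))
        convert h1 using 1
        · abel
        · cases b <;> simp only [near, far, if_true, Bool.false_eq_true, if_false, chip_zero] <;> abel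
      · refine Burns.linearSystem_eq_empty (ρ := ρ) fun v => ?_
        have h0 := hburn v
        have hsub : {h : E × Bool | Γ.near h = v ∧ ((ρ (Γ.far h) < ρ v ∧
            τ h.1 ∉ Ioo 0 (Γ.len h.1)) ∨ h.1 ∈ (∅ : Set E))} ⊆
            {h : E × Bool | Γ.near h = v ∧ ((ρ (Γ.far h) < ρ v ∧
            Function.update τ e 0 h.1 ∉ Ioo 0 (Γ.len h.1)) ∨ h.1 ∈ (∅ : Set E))} := by
          rintro d ⟨h1, h2⟩
          refine ⟨h1, Or.inl ⟨(h2.resolve_right (by simp)).1, ?_⟩⟩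
          by_cases hd : d.1 = e
          · rw [hd]; simp
          · rw [Function.update_of_ne hd]; exact (h2.resolve_right (by simp)).2
        by_cases hv : v = Γ.near (e, b)
        · subst hv
          have hlt := Set.ncard_lt_ncard (Set.ssubset_iff_of_subset hsub |>.2
            ⟨(e, b), ⟨rfl, Or.inl ⟨hb, by simp⟩⟩, fun hh =>
              (hh.2.resolve_right (by simp)).2 hτ⟩) (Set.toFinite _)
          simp only [Pi.add_apply, Pi.single_eq_same]
          omega
        · have hle := Set.ncard_le_ncard hsub (Set.toFinite _)
          simp only [Pi.add_apply, Pi.single_eq_of_ne hv]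
          omega
    · refine ⟨Γ.tgt e, hGw _ _ ?_ (hkeep (s + τ e - Γ.len e)
        ⟨by linarith, by linarith [hs.2, hτ.2]⟩)⟩
      rw [hupd]
      have := (linEquiv_merge_gt hs hτ h).add (LinEquiv.refl (Γ.config n τ - Γ.chip e (τ e)))
      convert this using 1 <;> abel
  -- Here `e` was free and the chip at `s` blocks it. Only the later end loses a burning dart, and
  -- its coefficient is lowered by one.
  · refine ⟨Γ.near (e, b), hGw _ (Γ.config (n + Pi.single (Γ.near (e, b)) (-1))
        (Function.update τ e s)) ?_ ?_⟩
    · rw [config_update, chip_of_notMem hτ, Finsupp.single_neg]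
      convert LinEquiv.refl (Γ.config n τ + Γ.chip e s) using 1
      abel
    · refine Burns.linearSystem_eq_empty (ρ := ρ) fun v => ?_
      have h0 := hburn v
      have hsub : {h : E × Bool | Γ.near h = v ∧ ((ρ (Γ.far h) < ρ v ∧
          τ h.1 ∉ Ioo 0 (Γ.len h.1)) ∨ h.1 ∈ (∅ : Set E))} \ {(e, b)} ⊆
          {h : E × Bool | Γ.near h = v ∧ ((ρ (Γ.far h) < ρ v ∧
          Function.update τ e s h.1 ∉ Ioo 0 (Γ.len h.1)) ∨ h.1 ∈ (∅ : Set E))} := by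
        rintro ⟨e', b'⟩ ⟨⟨h1, h2⟩, h3⟩
        have h4 := h2.resolve_right (by simp)
        refine ⟨h1, Or.inl ⟨h4.1, ?_⟩⟩
        by_cases hd : e' = e
        · subst hd
          have hb' : b' = !b := by
            cases b <;> cases b' <;> simp at h3 ⊢
          subst hb'
          rw [near_not] at h1
          rw [far_not, ← h1] at h4
          omega
        · rw [Function.update_of_ne hd]; exact h4.2
      have hle := Set.ncard_le_ncard hsub (Set.toFinite _)
      by_cases hv : v = Γ.near (e, b)
      · have := Set.pred_ncard_le_ncard_sdiff_singleton {h : E × Bool | Γ.near h = v ∧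
          ((ρ (Γ.far h) < ρ v ∧ τ h.1 ∉ Ioo 0 (Γ.len h.1)) ∨ h.1 ∈ (∅ : Set E))} (e, b)
        subst hv
        simp only [Pi.add_apply, Pi.single_eq_same]
        omega
      · rw [Set.sdiff_singleton_eq_self fun hh => hv hh.1.symm] at hle
        simp only [Pi.add_apply, Pi.single_eq_of_ne hv]
        omega

/-- The rank is determined by divisors supported on the vertices and on at most one interior point
of every loop. -/
theorem exists_config_on_loops [Nonempty V] (D : Γ.Divisor) : ∀ (k : ℕ) (a : V → ℤ) (s : E → ℝ),
    {e | Γ.src e ≠ Γ.tgt e ∧ s e ≠ 0}.ncard ≤ k → (∀ v, 0 ≤ a v) →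
    (∀ e, s e ∈ Ico 0 (Γ.len e)) → linearSystem (D - Γ.config a s) = ∅ →
    ∃ (a' : V → ℤ) (s' : E → ℝ), (∀ v, 0 ≤ a' v) ∧ (∀ e, s' e ∈ Ico 0 (Γ.len e)) ∧
      (∀ e, Γ.src e ≠ Γ.tgt e → s' e = 0) ∧ deg (Γ.config a' s') = deg (Γ.config a s) ∧
      linearSystem (D - Γ.config a' s') = ∅ := by
  classical
  intro k
  induction k with
  | zero =>
    intro a s hk ha hs hD
    refine ⟨a, s, ha, hs, fun e he => ?_, rfl, hD⟩
    by_contra hse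
    have := (Set.ncard_eq_zero (Set.toFinite _)).1 (Nat.le_zero.1 hk)
    exact Set.notMem_empty e (this ▸ ⟨he, hse⟩)
  | succ k ih =>
    intro a s hk ha hs hD
    by_cases hex : ∃ e, Γ.src e ≠ Γ.tgt e ∧ s e ≠ 0
    · obtain ⟨e, he, hse⟩ := hex
      have hs' : s e ∈ Ioo 0 (Γ.len e) := ⟨(hs e).1.lt_of_ne' hse, (hs e).2⟩
      obtain ⟨w, hw⟩ := exists_end_of_linearSystem_eq_empty he hs'
        (G := D - Γ.config a s + Γ.chip e (s e)) (by simpa using hD)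
      have heq : Γ.config (a + Pi.single w 1) (Function.update s e 0) =
          Γ.config a s + Finsupp.single (.vertex w) 1 - Γ.chip e (s e) := by
        rw [config_update, chip_zero, add_zero]
      obtain ⟨a', s', h1, h2, h3, h4, h5⟩ := ih (a + Pi.single w 1) (Function.update s e 0)
        (by
          have hlt : {e' | Γ.src e' ≠ Γ.tgt e' ∧ Function.update s e 0 e' ≠ 0}.ncard <
              {e | Γ.src e ≠ Γ.tgt e ∧ s e ≠ 0}.ncard := by
            refine Set.ncard_lt_ncard (Set.ssubset_iff_of_subset ?_ |>.2
              ⟨e, ⟨he, hse⟩, fun hh => hh.2 (by simp)⟩) (Set.toFinite _)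
            rintro e' ⟨h1, h2⟩
            refine ⟨h1, ?_⟩
            by_cases hh : e' = e
            · subst hh; simp at h2
            · rwa [Function.update_of_ne hh] at h2
          omega)
        (fun v => by
          have := ha v
          simp only [Pi.add_apply, Pi.single_apply]
          split_ifs <;> omega)
        (fun e' => by
          by_cases hh : e' = e
          · subst hh; simp [Γ.len_pos]
          · rw [Function.update_of_ne hh]; exact hs e')
        (by rw [heq, ← hw]; congr 1; abel)
      refine ⟨a', s', h1, h2, h3, ?_, h5⟩
      rw [h4, heq, deg_sub, deg_add, deg_single, deg_chip, if_pos hs']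
      ring
    · push Not at hex
      exact ⟨a, s, ha, hs, hex, rfl, hD⟩

end RankDetermining

/-! ### Spanning trees -/

section SpanningTree

variable {V E : Type*} [Finite E] {Γ : MetricGraph V E}

/-- In a connecting subset with the fewest edges, no edge has its ends joined by the others, as it
could be dropped. -/
lemma exists_spanningTree {X : Set E} (hX : ∀ u v, Γ.JoinedBy X u v) :
    ∃ T ⊆ X, Γ.IsSpanningTree T := by
  obtain ⟨T, ⟨hTX, hT⟩, hmin⟩ := WellFounded.has_min (measure (Set.ncard : Set E → ℕ)).wf
    {T | T ⊆ X ∧ ∀ u v, Γ.JoinedBy T u v} ⟨X, subset_rfl, hX⟩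
  refine ⟨T, hTX, hT, fun e he hj => ?_⟩
  refine hmin (T \ {e}) ⟨sdiff_subset.trans hTX, fun u v => ?_⟩
    (Set.ncard_sdiff_singleton_lt_of_mem he (Set.toFinite T))
  induction hT u v with
  | rel x y h =>
    obtain ⟨e', he', rfl, rfl⟩ := h
    by_cases hee : e' = e
    · rw [hee]; exact hj
    · exact Relation.EqvGen.rel _ _ ⟨e', ⟨he', hee⟩, rfl, rfl⟩
  | refl x => exact Relation.EqvGen.refl x
  | symm x y _ ih => exact Relation.EqvGen.symm _ _ ih
  | trans x y z _ _ ih1 ih2 => exact Relation.EqvGen.trans _ _ _ ih1 ih2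

end SpanningTree

end MetricGraph

namespace MetricGraph

/-! ### The upper bound for the rank -/

section PositivePart

variable {V E : Type*} {Γ : MetricGraph V E}

/-- The positive part of a divisor. -/
noncomputable def posPart (A : Γ.Divisor) : Γ.Divisor :=
  A.mapRange (max 0) (max_self 0)

lemma deg_posPart (A : Γ.Divisor) : deg (posPart A) = degPos A :=
  Finsupp.sum_mapRange_index fun _ => rfl

lemma posPart_nonneg (A : Γ.Divisor) : 0 ≤ posPart A := fun p => by
  simp [posPart]

lemma le_posPart (A : Γ.Divisor) : A ≤ posPart A := fun p => by
  simp [posPart]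

lemma degPos_le_deg {A F : Γ.Divisor} (hF : 0 ≤ F) (hA : A ≤ F) : degPos A ≤ deg F := by
  have h : 0 ≤ F - posPart A := fun p => by
    have h1 := hF p
    have h2 := hA p
    simp only [Finsupp.coe_zero, Pi.zero_apply] at h1
    simp only [posPart, Finsupp.coe_zero, Pi.zero_apply, Finsupp.sub_apply,
      Finsupp.mapRange_apply]
    omega
  have := deg_nonneg h
  rw [deg_sub, deg_posPart] at this
  omega

variable [Fintype E]

lemma exists_minimal_of_linearSystem_eq_empty [Finite V] [Nonempty V] (D : Γ.Divisor) :
    ∃ F : Γ.Divisor, 0 ≤ F ∧ linearSystem (D - F) = ∅ ∧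
      ∀ F' : Γ.Divisor, 0 ≤ F' → linearSystem (D - F') = ∅ → deg F ≤ deg F' := by
  classical
  have hex : ∃ N : ℕ, ∃ F : Γ.Divisor, 0 ≤ F ∧ linearSystem (D - F) = ∅ ∧ deg F = N := by
    obtain ⟨v⟩ := ‹Nonempty V›
    -- Enough chips to make the degree of `D - F` negative.
    let F : Γ.Divisor := Finsupp.single (.vertex v) (max 0 (deg D) + 1)
    have hF : 0 ≤ F := Finsupp.single_nonneg.2 (by positivity)
    refine ⟨(deg F).toNat, F, hF, ?_, (Int.toNat_of_nonneg (deg_nonneg hF)).symm⟩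
    rw [Set.eq_empty_iff_forall_notMem]
    rintro A ⟨hA, hAD⟩
    have h1 := deg_nonneg hA
    rw [hAD.deg_eq, deg_sub, deg_single] at h1
    omega
  obtain ⟨F, hF, hDF, hdeg⟩ := Nat.find_spec hex
  refine ⟨F, hF, hDF, fun F' hF' hDF' => ?_⟩
  have h1 := Nat.find_min' hex ⟨F', hF', hDF', (Int.toNat_of_nonneg (deg_nonneg hF')).symm⟩
  have h2 := deg_nonneg hF'
  omega

/-- The bound for the rank given by a permutation is attained as soon as it is at most the degree
of a minimal divisor `F` with `|D - F| = ∅`. -/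
lemma isRankPair_of_le [Nonempty V] {D D' F : Γ.Divisor} {P : List Γ.Point}
    (hP : ∀ v, Point.vertex v ∈ P) (hD : LinEquiv D D')
    (hF : ∀ F' : Γ.Divisor, 0 ≤ F' → linearSystem (D - F') = ∅ → deg F ≤ deg F')
    (hle : degPos (D' - nu P) ≤ deg F) : IsRankPair D D' P := by
  -- Subtracting the positive part of `D' - ν_P` from `D'` leaves a divisor below `ν_P`, so this
  -- positive part competes in the definition of the rank.
  refine ⟨hD.symm, ⟨posPart (D' - nu P), posPart_nonneg _, ?_, ?_⟩, ?_⟩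
  · rw [(hD.sub (LinEquiv.refl (posPart (D' - nu P)))).linearSystem_eq]
    refine linearSystem_eq_empty_of_le_nu hP ?_
    rw [sub_le_comm]
    exact le_posPart _
  · rw [deg_posPart]
  · rintro _ ⟨F', hF', hDF', rfl⟩
    have := hF F' hF' hDF'
    omega

end PositivePart

/-! ### Merging two configurations on loops -/

section Merging

variable {V E : Type*} [Fintype V] [Fintype E] {Γ : MetricGraph V E}

open Classical in
/-- The number of chips that reach the source when chips at `s e` and `τ e` are merged. -/
noncomputable def mergeCount (Γ : MetricGraph V E) (s τ : E → ℝ) (e : E) : ℕ :=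
  if s e ∈ Ioo 0 (Γ.len e) ∧ τ e ∈ Ioo 0 (Γ.len e) then
    if s e + τ e = Γ.len e then 2 else 1 else 0

lemma eq_zero_of_notMem_Ioo {x l : ℝ} (h : x ∈ Ico 0 l) (h' : x ∉ Ioo 0 l) : x = 0 := by
  by_contra hne
  exact h' ⟨h.1.lt_of_ne' hne, h.2⟩

omit [Fintype V] in
lemma linEquiv_merge {s τ : E → ℝ} {e : E} (hs : s e ∈ Ico 0 (Γ.len e))
    (hτ : τ e ∈ Ico 0 (Γ.len e)) (hloop : s e ≠ 0 → Γ.src e = Γ.tgt e) :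
    LinEquiv (Γ.chip e (s e) + Γ.chip e (τ e)) (Finsupp.single (.vertex (Γ.src e))
      (Γ.mergeCount s τ e : ℤ) + Γ.chip e (Γ.mergeParam e (s e) (τ e))) := by
  classical
  by_cases h1 : s e ∈ Ioo 0 (Γ.len e)
  · by_cases h2 : τ e ∈ Ioo 0 (Γ.len e)
    · have hl := hloop h1.1.ne'
      rcases lt_trichotomy (s e + τ e) (Γ.len e) with h | h | h
      · rw [mergeCount, if_pos ⟨h1, h2⟩, if_neg h.ne, mergeParam, if_pos h]
        exact linEquiv_merge_lt h1 h2 h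
      · rw [mergeCount, if_pos ⟨h1, h2⟩, if_pos h, mergeParam, if_neg h.not_lt, h, sub_self,
          chip_zero, add_zero]
        convert linEquiv_merge_eq h1 h2 h using 1
        rw [← hl, ← Finsupp.single_add]; rfl
      · rw [mergeCount, if_pos ⟨h1, h2⟩, if_neg h.ne', mergeParam, if_neg h.not_gt, hl]
        exact linEquiv_merge_gt h1 h2 h
    · have h0 := eq_zero_of_notMem_Ioo hτ h2
      rw [mergeCount, if_neg fun h => h2 h.2, mergeParam, h0, add_zero, if_pos h1.2, chip_zero]
      simpa using LinEquiv.refl _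
  · have h0 := eq_zero_of_notMem_Ioo hs h1
    rw [mergeCount, if_neg fun h => h1 h.1, mergeParam, h0, zero_add, if_pos hτ.2, chip_zero]
    simpa using LinEquiv.refl _

open Classical in
/-- The coefficients at the vertices after merging two configurations. -/
noncomputable def mergeCoeff (Γ : MetricGraph V E) (s τ : E → ℝ) (v : V) : ℤ :=
  ∑ e, if Γ.src e = v then (Γ.mergeCount s τ e : ℤ) else 0

lemma linEquiv_config_add {s τ : E → ℝ} (hs : ∀ e, s e ∈ Ico 0 (Γ.len e))
    (hτ : ∀ e, τ e ∈ Ico 0 (Γ.len e)) (hloop : ∀ e, s e ≠ 0 → Γ.src e = Γ.tgt e)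
    (a n : V → ℤ) : LinEquiv (Γ.config a s + Γ.config n τ)
      (Γ.config (a + n + Γ.mergeCoeff s τ) fun e => Γ.mergeParam e (s e) (τ e)) := by
  classical
  have h := (LinEquiv.sum Finset.univ fun e _ => linEquiv_merge (hs e) (hτ e) (hloop e)).add
    (LinEquiv.refl (∑ v, Finsupp.single (.vertex v) (a v) +
      ∑ v, Finsupp.single (.vertex v) (n v)))
  convert h using 1
  · rw [config, config, Finset.sum_add_distrib]; abel
  · have hv : (∑ e, Finsupp.single (Point.vertex (Γ.src e)) (Γ.mergeCount s τ e : ℤ) : Γ.Divisor) =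
        ∑ v, Finsupp.single (.vertex v) (Γ.mergeCoeff s τ v) := by
      ext p
      cases p <;> simp [Finsupp.single_apply, mergeCoeff]
    rw [config, Finset.sum_add_distrib, hv]
    simp only [Pi.add_apply, Finsupp.single_add, Finset.sum_add_distrib]
    abel

end Merging

/-! ### Construction of the rank-pair -/

section Main

variable {V E : Type*} [Fintype V] [Nonempty V] [Fintype E] {Γ : MetricGraph V E}

theorem exists_rankPair {I : Set Γ.Point} (hI : Γ.IsLoopTransversal I) (D : Γ.Divisor) :
    ∃ (n : V → ℤ) (τ : E → ℝ) (T : Set E) (P : List Γ.Point),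
      Γ.IsSpanningTree T ∧ Γ.IsPermutation I P ∧ IsRankPair D (Γ.config n τ) P ∧
      ∀ e ∈ T, τ e = 0 := by
  classical
  obtain ⟨σ, hσ, hIσ⟩ := hI.exists_param
  obtain ⟨F, hF, hDF, hmin⟩ := exists_minimal_of_linearSystem_eq_empty D
  obtain ⟨a₀, s₀, ha₀, hs₀, hFF⟩ := exists_config_of_nonneg hF
  obtain ⟨a, s, ha, hs, hsl, hdeg, hDs⟩ := exists_config_on_loops D _ a₀ s₀ le_rfl ha₀ hs₀
    (by rw [← hDF]; exact ((LinEquiv.refl D).sub hFF.symm).linearSystem_eq)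
  obtain ⟨n, τ, ρ, heq, hτ, -, hburn, hjoin⟩ := exists_burns_of_linearSystem_eq_empty hDs
  obtain ⟨T, hTX, hT⟩ := exists_spanningTree hjoin
  have hloop : ∀ e, s e ≠ 0 → Γ.src e = Γ.tgt e := fun e h => by
    by_contra hc; exact h (hsl e hc)
  let τ' : E → ℝ := fun e => Γ.mergeParam e (s e) (τ e)
  -- The chips of `D'` inside edges are shared out: where the reduced divisor has a chip, the merged
  -- one belongs to the part bounded by `ν_P`; elsewhere a chip of the minimal divisor stays in
  -- `F'`.
  let τR : E → ℝ := fun e => if τ e ∈ Ioo 0 (Γ.len e) then τ' e else 0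
  let sF : E → ℝ := fun e => if τ e ∈ Ioo 0 (Γ.len e) then 0 else s e
  -- The loops from which both chips reach the vertex. These pairs, counted by `z`, go to the part
  -- bounded by `ν_P`; the single chips that reach a vertex, counted by `C`, go to `F'`.
  let Z : Finset E := Finset.univ.filter fun e => Γ.mergeCount s τ e = 2
  let z : V → ℤ := fun v => ∑ e, if Γ.src e = v ∧ e ∈ Z then 2 else 0
  let C : E → ℤ := fun e => if e ∈ Z then 0 else Γ.mergeCount s τ e
  have hZ : ∀ e ∈ Z, s e ∈ Ioo 0 (Γ.len e) ∧ τ e ∈ Ioo 0 (Γ.len e) ∧ s e + τ e = Γ.len e := by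
    intro e he
    have h := (Finset.mem_filter.1 he).2
    unfold mergeCount at h
    split_ifs at h with h1 h2
    · exact ⟨h1.1, h1.2, h2⟩
    · omega
  have hZτ' : ∀ e ∈ Z, τ' e = 0 := by
    intro e he
    simp only [τ', mergeParam, (hZ e he).2.2, lt_irrefl, if_false, sub_self]
  have hτ'0 : ∀ e, s e = 0 → τ' e = τ e := by
    intro e he
    simp only [τ', mergeParam, he, zero_add, if_pos (hτ e).2]
  have hburn' : Γ.Burns (n + z) τR ρ Z := by
    intro v
    have h0 := hburn v
    have hz : z v = (({h : E × Bool | Γ.near h = v ∧ h.1 ∈ Z}.ncard : ℕ) : ℤ) := by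
      rw [Set.ncard_eq_toFinset_card', Set.toFinset_ofPred, Finset.natCast_card_filter,
        Fintype.sum_prod_type]
      refine Finset.sum_congr rfl fun e _ => ?_
      by_cases he : e ∈ Z
      · have := hloop e (hZ e he).1.1.ne'
        simp only [near, Fintype.sum_bool, if_true, Bool.false_eq_true, if_false, ← this]
        split_ifs <;> rfl
      · simp [he]
    rw [Pi.add_apply, hz]
    -- A loop of `Z` was blocked by its chip, so its two darts are new and pay for the two chips in
    -- `z`.
    have hdisj : Disjoint {h : E × Bool | Γ.near h = v ∧ ((ρ (Γ.far h) < ρ v ∧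
        τ h.1 ∉ Ioo 0 (Γ.len h.1)) ∨ h.1 ∈ (∅ : Set E))}
        {h : E × Bool | Γ.near h = v ∧ h.1 ∈ Z} := by
      rw [Set.disjoint_left]
      rintro d ⟨-, h2⟩ ⟨-, h4⟩
      exact (h2.resolve_right (by simp)).2 (hZ _ h4).2.1
    have hunion := Set.ncard_union_eq hdisj (Set.toFinite _) (Set.toFinite _)
    have hsub := Set.ncard_le_ncard (s := {h : E × Bool | Γ.near h = v ∧ ((ρ (Γ.far h) < ρ v ∧
        τ h.1 ∉ Ioo 0 (Γ.len h.1)) ∨ h.1 ∈ (∅ : Set E))} ∪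
        {h : E × Bool | Γ.near h = v ∧ h.1 ∈ Z})
      (t := {h : E × Bool | Γ.near h = v ∧ ((ρ (Γ.far h) < ρ v ∧
        τR h.1 ∉ Ioo 0 (Γ.len h.1)) ∨ h.1 ∈ (Z : Set E))}) (by
        rintro d (⟨h1, h2⟩ | ⟨h1, h2⟩)
        · have h3 := h2.resolve_right (by simp)
          refine ⟨h1, Or.inl ⟨h3.1, ?_⟩⟩
          simp only [τR, if_neg h3.2]
          exact fun h => lt_irrefl _ h.1
        · exact ⟨h1, Or.inr h2⟩) (Set.toFinite _)
    omega
  obtain ⟨P, hP, hle⟩ := hburn'.exists_permutation hσ hIσ fun e he => by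
    refine ⟨hloop e (hZ e he).1.1.ne', ?_⟩
    simp only [τR, hZτ' e he, ite_self]
    exact fun h => lt_irrefl _ h.1
  let D' := Γ.config (a + n + Γ.mergeCoeff s τ) τ'
  let aF : V → ℤ := fun v => a v + ∑ e, if Γ.src e = v then C e else 0
  -- The chips at `σ e` compensate those subtracted in `hle`.
  let F' := Γ.config aF sF + ∑ e ∈ Z, Γ.chip e (σ e)
  have hC : ∀ e, 0 ≤ C e := fun e => by simp only [C]; split_ifs <;> omega
  have hF' : 0 ≤ F' := by
    refine add_nonneg (config_nonneg (fun v => add_nonneg (ha v) ?_) _)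
      (Finset.sum_nonneg fun e _ => chip_nonneg _ _)
    exact Finset.sum_nonneg fun e _ => by split_ifs; exacts [hC e, le_rfl]
  have hcoeff : a + n + Γ.mergeCoeff s τ = n + z + aF := by
    have h : Γ.mergeCoeff s τ = fun v => z v + ∑ e, if Γ.src e = v then C e else 0 := by
      ext v
      simp only [mergeCoeff, z, ← Finset.sum_add_distrib]
      refine Finset.sum_congr rfl fun e _ => ?_
      by_cases he : e ∈ Z
      · have := (Finset.mem_filter.1 he).2
        simp [C, he, this]
      · simp [C, he]
    rw [h]
    ext v
    simp only [Pi.add_apply, aF]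
    ring
  have hD'F' : D' = (Γ.config (n + z) τR - ∑ e ∈ Z, Γ.chip e (σ e)) + F' := by
    have h : D' = Γ.config (n + z) τR + Γ.config aF sF := by
      ext p
      cases p with
      | vertex v => simp only [D', hcoeff, Finsupp.add_apply, config_vertex, Pi.add_apply]
      | inner e t =>
        simp only [D', Finsupp.add_apply, config_inner, τR, sF]
        have ht : (0 : ℝ) ≠ t := t.2.1.ne
        by_cases hτe : τ e ∈ Ioo 0 (Γ.len e)
        · simp only [hτe, if_true, ht, if_false, add_zero]
        · have : τ' e = s e := by
            simp only [τ', mergeParam, eq_zero_of_notMem_Ioo (hτ e) hτe, add_zero,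
              if_pos (hs e).2]
          simp only [hτe, if_false, ht, zero_add, this]
    rw [h]; simp only [F']; abel
  -- Each chip at `s e` has exactly one successor in `F'`: at `s e` itself, at the vertex of the
  -- loop, or, for `e ∈ Z`, at `σ e`.
  have hdegF' : deg F' = deg F := by
    rw [hFF.deg_eq, ← hdeg]
    simp only [F']
    rw [deg_add, deg_config, deg_config, deg_sum]
    have h1 : ∑ v, aF v = ∑ v, a v + ∑ e, C e := by
      simp only [aF, Finset.sum_add_distrib]
      rw [Finset.sum_comm]
      simp
    have h2 : ∑ e ∈ Z, deg (Γ.chip e (σ e)) = ∑ e, if e ∈ Z then 1 else 0 := by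
      rw [← Finset.sum_filter, Finset.filter_mem_eq_inter, Finset.univ_inter]
      refine Finset.sum_congr rfl fun e he => ?_
      rw [deg_chip, if_pos (hσ e (hloop e (hZ e he).1.1.ne'))]
    rw [h1, h2, add_assoc, add_assoc, ← Finset.sum_add_distrib, ← Finset.sum_add_distrib]
    congr 1
    refine Finset.sum_congr rfl fun e _ => ?_
    have h0 : (0 : ℝ) ∉ Ioo 0 (Γ.len e) := fun h => lt_irrefl _ h.1
    by_cases heZ : e ∈ Z
    · simp only [C, sF, heZ, if_true, (hZ e heZ).1, (hZ e heZ).2.1, h0, if_false]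
      rfl
    · have hne : Γ.mergeCount s τ e ≠ 2 := fun h =>
        heZ (Finset.mem_filter.2 ⟨Finset.mem_univ e, h⟩)
      simp only [C, sF, heZ, if_false, add_zero]
      unfold mergeCount at hne ⊢
      by_cases h3 : τ e ∈ Ioo 0 (Γ.len e)
      · by_cases h4 : s e ∈ Ioo 0 (Γ.len e)
        · have h5 : s e + τ e ≠ Γ.len e := fun h => hne (by rw [if_pos ⟨h4, h3⟩, if_pos h])
          simp only [h3, h4, h5, h0, and_self, if_true, if_false]; rfl
        · simp only [h3, h4, h0, false_and, if_true, if_false]; rfl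
      · simp only [h3, and_false, if_false]; simp
  have hDD' : LinEquiv D D' := by
    have h1 := (LinEquiv.refl (Γ.config a s)).add heq
    rw [add_sub_cancel] at h1
    exact h1.trans (linEquiv_config_add hs hτ hloop a n)
  refine ⟨_, τ', T, P, hT, hP, isRankPair_of_le hP.2.1 hDD' hmin ?_, fun e he => ?_⟩
  · rw [← hdegF']
    refine degPos_le_deg hF' ?_
    change D' - nu P ≤ F'
    rw [hD'F', add_sub_right_comm]
    exact add_le_of_nonpos_left (sub_nonpos.2 hle)
  -- A tree edge is not a loop, so the minimal divisor has no chip on it; the reduced one has none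
  -- by the choice of `T`.
  · have hnl : Γ.src e ≠ Γ.tgt e := fun h => hT.2 e he (h ▸ Relation.EqvGen.refl _)
    rw [hτ'0 e (hsl e hnl)]
    exact eq_zero_of_notMem_Ioo (hτ e) (hTX he)

end Main

end MetricGraph

theorem mainTheorem7 {V E : Type*} [Finite V] [Nonempty V] [Fintype E] (Γ : MetricGraph V E)
    (I : Set Γ.Point) (hI : Γ.IsLoopTransversal I) (D : Γ.Divisor) :
    ∃ (D' : Γ.Divisor) (T : Set E) (P : List Γ.Point),
      Γ.IsSpanningTree T ∧ Γ.IsPermutation I P ∧ MetricGraph.IsRankPair D D' P ∧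
      (∀ e ∈ T, ∀ p ∈ Γ.interior e, D' p = 0) ∧
      ∀ e ∉ T, {p ∈ Γ.interior e | D' p ≠ 0}.Subsingleton ∧
        ∀ p ∈ Γ.interior e, D' p ≠ 0 → D' p = 1 := by
  classical
  cases nonempty_fintype V
  obtain ⟨n, τ, T, P, hT, hP, hDP, hτ⟩ := MetricGraph.exists_rankPair hI D
  have hval : ∀ e (t : Set.Ioo (0 : ℝ) (Γ.len e)),
      Γ.config n τ (.inner e t) ≠ 0 → τ e = t ∧ Γ.config n τ (.inner e t) = 1 := by
    intro e t h
    rw [MetricGraph.config_inner] at h ⊢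
    by_cases hte : τ e = t
    · exact ⟨hte, if_pos hte⟩
    · exact absurd (if_neg hte) h
  refine ⟨Γ.config n τ, T, P, hT, hP, hDP, ?_, fun e _ => ⟨?_, ?_⟩⟩
  · rintro e he _ ⟨t, rfl⟩
    by_contra h
    have := (hval e t h).1
    rw [hτ e he] at this
    exact t.2.1.ne this
  · rintro _ ⟨⟨t, rfl⟩, ht⟩ _ ⟨⟨t', rfl⟩, ht'⟩
    rw [Subtype.ext ((hval e t ht).1.symm.trans (hval e t' ht').1)]
  · rintro _ ⟨t, rfl⟩ h
    exact (hval e t h).2
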